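/- Let $F$ be a finite field with $|F|=q$ and $\operatorname{char}F=2$, and let $h_q(\delta)=\delta\log_q(q-1)-\delta\log_q\delta-(1-\delta)\log_q(1-\delta)$. Let $\delta$ be a real number with $0<\delta<1-q^{-1}$ and $0<h_q(\delta)<\frac14$. *Conventions.* For $n>1$ let $G=\langle u,v\mid u^n=v^2=1,\ vuv^{-1}=u^{-1}\rangle$ be the dihedral group of order $2n$ and $H=\langle u\rangle$. A dihedral group code of length $2n$ over $F$ is a left ideal $C$ of the group algebra $FG$. The element $\sum_{x\in G}a_xx$ is identified with the word $(a_x)_{x\in G}$; $\Delta(C)$ is the minimum Hamming distance between distinct words of $C$, divided by $2n$. $C$ is self-dual if $C=C^\perp$ for the Euclidean inner product $\langle a,b\rangle=\sum_x a_xb_x$. Write $\overline{\sum a_xx}=\sum a_xx^{-1}$. Let $n>1$ be odd and coprime to $q$. Put $e_0=\frac1n\sum_{x\in H}x$, $\widehat e_0=e_0+ve_0$ and $C_0=F\widehat e_0$. Let $\varepsilon_1,\dots,\varepsilon_m$ be the distinct elements of the form $e+\overline e$ (if $\overline e\neq e$) or $e$ (if $\overline e=e$), where $e\ne e_0$ runs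 over the primitive idempotents of $FH$, and let $A_t=FG\varepsilon_t$. Choose for every $t=1,\dots,m$ an $F$-algebra isomorphism $A_t\cong \mathrm M_2(F_t)$ with $F_t$ an extension field of $F$, and an $F_t$-subalgebra of $\mathrm M_2(F_t)$ which is a field of degree $2$ over $F_t$; let $K_t\subseteq A_t$ correspond to this field, and let $C_t\subseteq A_t$ correspond to $\mathrm M_2(F_t)\begin{pmatrix}1&0\\0&0\end{pmatrix}$. Put $\widehat C=C_0\oplus C_1\oplus\cdots\oplus C_m$ and $K^*=\{e_0+\kappa_1+\cdots+\kappa_m\mid 0\ne\kappa_t\in K_t\}$. For $(\alpha,\beta)$ uniformly distributed on $K^*\times K^*$ let $\widehat C_{\alpha,\beta}=\alpha\widehat C\beta$. *Theorem.* (a) There are self-dual dihedral group codes $C_1,C_2,\dots$ over $F$, with length of $C_i$ going to infinity, such that $\Delta(C_i)>\delta$ for all $i$. (b) There is a sequence $n_1,n_2,\dots$ of odd integers $n_i>1$ coprime to $q$ with $n_i\to\infty$ such that for $n=n_i$ the choices described above exist and, whatever choices are made for each $n_i$, every code $\widehat C^{(i)}_{\alpha,\beta}$ with $(\alpha,\beta)\in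 K^*\times K^*$ (for $n=n_i$) is a self-dual dihedral group code, and $$\lim_{i\to\infty}\Pr\big(\Delta(\widehat C^{(i)}_{\alpha,\beta})>\delta\big)=1 .$$ -/

import Mathlib

universe u

noncomputable section

namespace DihedralCode

/-- The `q`-entropy function `h_q`. -/
def qEntropy (q : ℕ) (δ : ℝ) : ℝ :=
  δ * Real.logb q ((q : ℝ) - 1) - δ * Real.logb q δ - (1 - δ) * Real.logb q (1 - δ)

section GroupCodes

variable {F : Type u} [Field F] {G : Type} [Group G]

/-- Hamming weight of an element of `FG`, viewed as the word `(a_x)_{x ∈ G}`. -/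
def weight (a : MonoidAlgebra F G) : ℕ := a.coeff.support.card

/-- Minimum distance: the least Hamming distance of two different words of the code. -/
def minDist (C : Set (MonoidAlgebra F G)) : ℕ :=
  sInf {d | ∃ c ∈ C, ∃ c' ∈ C, c ≠ c' ∧ d = weight (c - c')}

/-- Relative minimum distance `Δ(C)`; the length of the code is `|G|`. -/
def relMinDist (C : Set (MonoidAlgebra F G)) : ℝ := (minDist C : ℝ) / (Nat.card G : ℝ)

/-- Euclidean inner product `∑ₓ aₓ bₓ`. -/
def innerProd (a b : MonoidAlgebra F G) : F := ∑ x ∈ a.coeff.support, a.coeff x * b.coeff x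

/-- The orthogonal code. -/
def orthogonalCode (C : Set (MonoidAlgebra F G)) : Set (MonoidAlgebra F G) :=
  {a | ∀ c ∈ C, innerProd c a = 0}

def IsSelfDual (C : Set (MonoidAlgebra F G)) : Prop := C = orthogonalCode C

/-- A group code is a left ideal of `FG` (`Ideal` means left ideal in Mathlib). -/
def IsGroupCode (C : Set (MonoidAlgebra F G)) : Prop :=
  ∃ I : Ideal (MonoidAlgebra F G), (I : Set (MonoidAlgebra F G)) = C

/-- The map `∑ aₓ x ↦ ∑ aₓ x⁻¹`. -/
def bar (a : MonoidAlgebra F G) : MonoidAlgebra F G :=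
  MonoidAlgebra.mapDomain (fun x : G => x⁻¹) a

end GroupCodes

/-- The group algebra of the dihedral group of order `2n`. -/
abbrev FG (F : Type u) [Field F] (n : ℕ) : Type u := MonoidAlgebra F (DihedralGroup n)

section Dihedral

variable (F : Type u) [Field F] (n : ℕ)

/-- The rotation `u`, as an element of `FG`. -/
def rot : FG F n := MonoidAlgebra.of F (DihedralGroup n) (DihedralGroup.r 1)

/-- The involution `v`, as an element of `FG`; it satisfies `v u v⁻¹ = u⁻¹`. -/
def reflv : FG F n := MonoidAlgebra.of F (DihedralGroup n) (DihedralGroup.sr 0)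

/-- The group algebra `FH` of `H = ⟨u⟩`, as a subalgebra of `FG`. -/
def FH : Subalgebra F (FG F n) :=
  (MonoidAlgebra.mapDomainAlgHom F F
    (Subgroup.zpowers (DihedralGroup.r 1 : DihedralGroup n)).subtype).range

/-- `e₀ = (1/n) ∑_{x ∈ H} x`. -/
def e0 : FG F n := (n : F)⁻¹ • ∑ i ∈ Finset.range n, rot F n ^ i

/-- `ê₀ = e₀ + v e₀`. -/
def e0hat : FG F n := e0 F n + reflv F n * e0 F n

/-- `e` is a primitive idempotent of `FH`: it is an idempotent and `FH e` is a minimal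
(nonzero) ideal of `FH`. -/
def IsPrimitiveIdempotentFH (e : FG F n) : Prop :=
  ∃ f : FH F n, (f : FG F n) = e ∧ IsIdempotentElem f ∧ IsAtom (Ideal.span {f})

/-- The identities `1_{A_t}`, `t ≥ 1`, of the blocks of `FG` other than `A_0 = FG e₀`:
the elements `e + ē` (if `ē ≠ e`) and `e` (if `ē = e`), where `e ≠ e₀` runs over
the primitive idempotents of `FH`. The blocks `A_t`, `t ≥ 1`, are indexed by this set. -/
def blockIds : Set (FG F n) :=
  {ε | ∃ e, IsPrimitiveIdempotentFH F n e ∧ e ≠ e0 F n ∧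
    ((bar e ≠ e ∧ ε = e + bar e) ∨ (bar e = e ∧ ε = e))}

/-- A choice of an identification of the ideal `A_t = FG ε` of `FG` with a matrix algebra
`M₂(L)` over an extension field `L` of `F`, and of an `L`-subalgebra `E` of `M₂(L)` which is a
field of degree 2 over `L`. -/
structure BlockChoice (ε : FG F n) where
  L : Type u
  [field : Field L]
  [algebra : Algebra F L]
  /-- the `F`-algebra isomorphism `M₂(L) ≅ FG ε`, composed with the inclusion into `FG` -/
  φ : Matrix (Fin 2) (Fin 2) L →ₙₐ[F] FG F n
  injective_φ : Function.Injective φ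
  range_φ : Set.range φ = {x | ∃ a : FG F n, x = a * ε}
  E : Subalgebra L (Matrix (Fin 2) (Fin 2) L)
  isField_E : IsField E
  finrank_E : Module.finrank L E = 2

attribute [instance] BlockChoice.field BlockChoice.algebra

variable {F n}

/-- The field `K_t ⊆ A_t` corresponding to `E`. -/
def BlockChoice.K {ε : FG F n} (B : BlockChoice F n ε) : Set (FG F n) :=
  {x | ∃ a ∈ B.E, x = B.φ a}

/-- The simple left ideal `C_t` of `A_t` corresponding to `M₂(L) ε₁₁`. -/
def BlockChoice.C {ε : FG F n} (B : BlockChoice F n ε) : Submodule F (FG F n) :=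
  Submodule.span F
    {x | ∃ a : Matrix (Fin 2) (Fin 2) B.L, x = B.φ (a * Matrix.single 0 0 1)}

/-- `Ĉ = C₀ ⊕ C₁ ⊕ ⋯ ⊕ C_m`, where `C₀ = F ê₀`. -/
def Chat (B : ∀ ε : blockIds F n, BlockChoice F n (ε : FG F n)) : Submodule F (FG F n) :=
  Submodule.span F {e0hat F n} ⊔ ⨆ ε, (B ε).C

/-- `K^* = {e₀} × K₁^× × ⋯ × K_m^×`, consisting of the elements `e₀ + κ₁ + ⋯ + κ_m` with
`0 ≠ κ_t ∈ K_t`. -/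
def Kstar (B : ∀ ε : blockIds F n, BlockChoice F n (ε : FG F n)) : Set (FG F n) :=
  {x | ∃ κ : blockIds F n → FG F n, (∀ ε, κ ε ∈ (B ε).K ∧ κ ε ≠ 0) ∧
    x = e0 F n + ∑ᶠ ε, κ ε}

/-- The code `α Ĉ β`. -/
def randomCode (B : ∀ ε : blockIds F n, BlockChoice F n (ε : FG F n)) (α β : FG F n) :
    Set (FG F n) :=
  {x | ∃ c ∈ Chat B, x = α * c * β}

/-- The probability of `Δ(α Ĉ β) > δ`, for `(α, β)` uniformly distributed on `K^* × K^*`. -/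
def probGT (B : ∀ ε : blockIds F n, BlockChoice F n (ε : FG F n)) (δ : ℝ) : ℝ :=
  (({p ∈ Kstar B ×ˢ Kstar B | δ < relMinDist (randomCode B p.1 p.2)}.ncard : ℕ) : ℝ) /
    (((Kstar B ×ˢ Kstar B).ncard : ℕ) : ℝ)

end Dihedral

end DihedralCode

end

noncomputable section

namespace DihedralCode

open DihedralGroup

/-! ### The involution `bar` and Euclidean duality in a group algebra -/

section GroupAlgebra
variable {F : Type u} [Field F] {G : Type} [Group G]

/-! Self-duality. The Euclidean form is the coefficient of 1 in `a * bar b`, so the dual of a left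
ideal is an annihilator. In characteristic 2 every norm `x * bar x` and every trace `x + bar x` in
the dihedral group algebra is central (`exists_mul_bar`, `exists_add_bar`). In a block `M₂(L)`
central means scalar, and this forces `bar p = ε - p` for the rank one idempotent `p` generating
`C_t` (`p_add_bar_p`); so `C_t` is the annihilator of `bar p`, while `F ê₀` is its own annihilator
in `FG e₀`. Hence `Ĉ` is self-dual, and so is `Ĉ β`, because `β * bar β` is a central unit. The
factor `α` plays no role: `Ĉ` is a left ideal and `α` is a unit.

Distance. Write `h = h_q(δ)` and let `Q_t` be the order of the centre of the block `A_t`. A word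
whose nonzero block components are those in a set `T` lies in `Ĉ β` for a proportion of at most
`∏_{t ∈ T} Q_t⁻¹` of all `β` (`ncard_mul_prod_le`). All such words lie in a two-sided ideal of at
most `q² ∏_{t ∈ T} Q_t⁴` elements, and a group code `I` has at most `|I|^h` words of relative weight
at most `δ` (`ncard_weight_le`). Words with no block component in the code are multiples of `ê₀` and
have full weight. The union bound over nonempty `T` gives a failure probability of at most `q^(2h)
(∏ (1 + Q_t^(4h-1)) - 1)` (`ncard_bad_le`), where `4h - 1 < 0`.

Choice of `n`. For a prime `n` not dividing `q`, with `s` the order of `q` modulo `n`, one has `Q_t²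
≥ q^s` (`pow_orderOf_le_Q_sq`), and there are at most `2n` blocks. Primes with `s³ < n` have a
convergent sum of reciprocals, so infinitely many primes satisfy `n ≤ s³`
(`exists_prime_large_order`); along these the bound tends to 0. Part (a) follows, since a positive
probability exhibits a good code. -/

lemma bar_single (g : G) (r : F) : bar (MonoidAlgebra.single g r) = MonoidAlgebra.single g⁻¹ r := by
  simp [bar]

lemma bar_add (a b : MonoidAlgebra F G) : bar (a + b) = bar a + bar b :=
  MonoidAlgebra.mapDomain_add ..

lemma bar_smul (r : F) (a : MonoidAlgebra F G) : bar (r • a) = r • bar a :=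
  MonoidAlgebra.mapDomain_smul ..

/-- `bar` as a linear map. -/
def barL : MonoidAlgebra F G →ₗ[F] MonoidAlgebra F G where
  toFun := bar
  map_add' := bar_add
  map_smul' := bar_smul

lemma bar_zero : bar (0 : MonoidAlgebra F G) = 0 := map_zero (barL (F := F) (G := G))

lemma bar_sum {ι : Type*} (s : Finset ι) (f : ι → MonoidAlgebra F G) :
    bar (∑ i ∈ s, f i) = ∑ i ∈ s, bar (f i) := map_sum barL f s

lemma bar_bar (a : MonoidAlgebra F G) : bar (bar a) = a := by
  induction a using MonoidAlgebra.induction_linear with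
  | zero => simp [bar_zero]
  | add x y hx hy => simp [bar_add, hx, hy]
  | single g r => simp [bar_single]

lemma bar_injective : Function.Injective (bar (F := F) (G := G)) :=
  Function.LeftInverse.injective bar_bar

lemma bar_mul (a b : MonoidAlgebra F G) : bar (a * b) = bar b * bar a := by
  induction a using MonoidAlgebra.induction_linear with
  | zero => simp [bar_zero]
  | add x y hx hy => simp [bar_add, hx, hy, add_mul, mul_add]
  | single g r =>
    induction b using MonoidAlgebra.induction_linear with
    | zero => simp [bar_zero]
    | add x y hx hy => simp [bar_add, hx, hy, add_mul, mul_add]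
    | single h s => simp [bar_single, MonoidAlgebra.single_mul_single, mul_comm]

lemma bar_one : bar (1 : MonoidAlgebra F G) = 1 := by
  simp [MonoidAlgebra.one_def, bar_single]

lemma coeff_bar (a : MonoidAlgebra F G) (x : G) : (bar a).coeff x = a.coeff x⁻¹ := by
  induction a using MonoidAlgebra.induction_linear with
  | zero => simp [bar_zero]
  | add x y hx hy => simp [bar_add, hx, hy]
  | single g r =>
    classical
    simp [bar_single, Finsupp.single_apply, inv_eq_iff_eq_inv]

/-- This turns orthogonality into multiplication in the algebra. -/
lemma innerProd_eq (a b : MonoidAlgebra F G) : innerProd a b = (a * bar b).coeff 1 := by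
  classical
  have h : innerProd a b = a.coeff.sum fun x r => r * b.coeff x := rfl
  rw [h]
  clear h
  induction a using MonoidAlgebra.induction_linear with
  | zero => simp
  | add x y hx hy =>
    rw [add_mul, MonoidAlgebra.coeff_add, MonoidAlgebra.coeff_add, Finsupp.add_apply, ← hx, ← hy, Finsupp.sum_add_index']
    · simp
    · intros; ring
  | single g r =>
    simp [coeff_bar]

/-- The coefficient of `c * bar a` at `x` is the inner product of `x⁻¹ c` with `a`, and a left ideal
is stable under translation by `x⁻¹`. -/
lemma mem_orthogonalCode_iff (I : Ideal (MonoidAlgebra F G)) (a : MonoidAlgebra F G) :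
    a ∈ orthogonalCode (I : Set (MonoidAlgebra F G)) ↔ ∀ c ∈ I, c * bar a = 0 := by
  constructor
  · intro h c hc
    ext x
    have := h _ (I.mul_mem_left (MonoidAlgebra.single x⁻¹ 1) hc)
    rw [innerProd_eq, mul_assoc] at this
    simpa using this
  · intro h c hc
    rw [innerProd_eq, h c hc]
    simp

omit [Group G] in
lemma finite_monoidAlgebra [Finite F] [Finite G] : Finite (MonoidAlgebra F G) :=
  have : Finite (G →₀ F) := Finite.of_injective _ DFunLike.coe_injective
  Finite.of_equiv (G →₀ F) MonoidAlgebra.coeffEquiv.symm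

end GroupAlgebra

/-! ### The dihedral group algebra as `FH ⊕ FH v` -/

section Dihedral
variable (F : Type u) [Field F] (n : ℕ)

lemma rot_pow (k : ℕ) : rot F n ^ k = MonoidAlgebra.single (r (k : ZMod n)) 1 := by
  rw [rot, ← map_pow, DihedralGroup.r_one_pow]
  rfl

lemma reflv_mul_reflv : reflv F n * reflv F n = 1 := by
  rw [reflv, ← map_mul, sr_mul_self, map_one]

lemma bar_reflv : bar (reflv F n) = reflv F n := by
  simp [reflv, MonoidAlgebra.of_apply, bar_single]

lemma mem_zpowers_iff (x : DihedralGroup n) :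
    x ∈ Subgroup.zpowers (r 1 : DihedralGroup n) ↔ ∃ i, x = r i := by
  constructor
  · rintro ⟨k, rfl⟩
    exact ⟨k, by simp⟩
  · rintro ⟨i, rfl⟩
    obtain ⟨k, rfl⟩ := ZMod.intCast_surjective i
    exact ⟨k, by simp⟩

lemma FH_toSubmodule : Subalgebra.toSubmodule (FH F n) =
    Submodule.span F (Set.range fun i : ZMod n => (MonoidAlgebra.single (r i) 1 : FG F n)) := by
  apply le_antisymm
  · rintro _ ⟨a, rfl⟩
    induction a using MonoidAlgebra.induction_linear with
    | zero => simp
    | add x y hx hy => rw [map_add]; exact add_mem hx hy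
    | single g c =>
      obtain ⟨i, hi⟩ := (mem_zpowers_iff n g.1).1 g.2
      have : (MonoidAlgebra.mapDomainAlgHom F F
        (Subgroup.zpowers (DihedralGroup.r 1 : DihedralGroup n)).subtype) (MonoidAlgebra.single g c)
          = c • MonoidAlgebra.single (r i) 1 := by
        simp [hi]
      erw [this]
      exact Submodule.smul_mem _ _ (Submodule.subset_span ⟨i, rfl⟩)
  · rw [Submodule.span_le]
    rintro _ ⟨i, rfl⟩
    exact ⟨MonoidAlgebra.single ⟨r i, (mem_zpowers_iff n _).2 ⟨i, rfl⟩⟩ 1, by simp⟩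

variable {F n}

lemma single_r_mem_FH (i : ZMod n) : (MonoidAlgebra.single (r i) 1 : FG F n) ∈ FH F n := by
  rw [← Subalgebra.mem_toSubmodule, FH_toSubmodule]
  exact Submodule.subset_span ⟨i, rfl⟩

@[elab_as_elim]
lemma FH_induction {p : ∀ a : FG F n, a ∈ FH F n → Prop} (zero : p 0 (zero_mem _))
    (add : ∀ x y hx hy, p x hx → p y hy → p (x + y) (add_mem hx hy))
    (smul : ∀ (c : F) x hx, p x hx → p (c • x) (Subalgebra.smul_mem _ hx c))
    (single : ∀ i, p (MonoidAlgebra.single (r i) 1) (single_r_mem_FH i))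
    {a : FG F n} (ha : a ∈ FH F n) : p a ha := by
  have ha' := ha
  rw [← Subalgebra.mem_toSubmodule, FH_toSubmodule] at ha'
  have : ∃ h, p a h := by
    induction ha' using Submodule.span_induction with
    | mem x h => obtain ⟨i, rfl⟩ := h; exact ⟨_, single i⟩
    | zero => exact ⟨_, zero⟩
    | add x y h h' hx hy =>
      rw [← FH_toSubmodule, Subalgebra.mem_toSubmodule] at h h'
      obtain ⟨_, hx⟩ := hx h
      obtain ⟨_, hy⟩ := hy h'
      exact ⟨_, add x y _ _ hx hy⟩
    | smul c x h hx =>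
      rw [← FH_toSubmodule, Subalgebra.mem_toSubmodule] at h
      obtain ⟨_, hx⟩ := hx h
      exact ⟨_, smul c x _ hx⟩
  exact this.2

lemma rot_mem_FH : rot F n ∈ FH F n := single_r_mem_FH 1

lemma FH_mul_comm {a b : FG F n} (ha : a ∈ FH F n) (hb : b ∈ FH F n) : a * b = b * a := by
  induction ha using FH_induction with
  | zero => simp
  | add x y _ _ hx hy => rw [add_mul, hx, hy, mul_add]
  | smul c x _ hx => rw [smul_mul_assoc, hx, mul_smul_comm]
  | single i =>
    induction hb using FH_induction with
    | zero => simp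
    | add x y _ _ hx hy => rw [mul_add, hx, hy, add_mul]
    | smul c x _ hx => rw [smul_mul_assoc, ← hx, mul_smul_comm]
    | single j => simp [MonoidAlgebra.single_mul_single, add_comm]

lemma bar_mem_FH {a : FG F n} (ha : a ∈ FH F n) : bar a ∈ FH F n := by
  induction ha using FH_induction with
  | zero => rw [bar_zero]; exact zero_mem _
  | add x y _ _ hx hy => rw [bar_add]; exact add_mem hx hy
  | smul c x _ hx => rw [bar_smul]; exact Subalgebra.smul_mem _ hx c
  | single i => rw [bar_single, inv_r]; exact single_r_mem_FH _

lemma bar_mul_of_mem_FH {a b : FG F n} (ha : a ∈ FH F n) (hb : b ∈ FH F n) :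
    bar (a * b) = bar a * bar b := by
  rw [bar_mul, FH_mul_comm (bar_mem_FH hb) (bar_mem_FH ha)]

lemma reflv_mul {a : FG F n} (ha : a ∈ FH F n) : reflv F n * a = bar a * reflv F n := by
  induction ha using FH_induction with
  | zero => simp [bar_zero]
  | add x y _ _ hx hy => rw [mul_add, hx, hy, bar_add, add_mul]
  | smul c x _ hx => rw [mul_smul_comm, hx, bar_smul, smul_mul_assoc]
  | single i => simp [bar_single, reflv, MonoidAlgebra.single_mul_single]

lemma exists_eq_add_mul_reflv (x : FG F n) :
    ∃ a ∈ FH F n, ∃ b ∈ FH F n, x = a + b * reflv F n := by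
  induction x using MonoidAlgebra.induction_linear with
  | zero => exact ⟨0, zero_mem _, 0, zero_mem _, by simp⟩
  | add x y hx hy =>
    obtain ⟨a, ha, b, hb, rfl⟩ := hx
    obtain ⟨a', ha', b', hb', rfl⟩ := hy
    exact ⟨a + a', add_mem ha ha', b + b', add_mem hb hb', by rw [add_mul]; abel⟩
  | single g c =>
    cases g with
    | r i =>
      refine ⟨c • MonoidAlgebra.single (r i) 1, Subalgebra.smul_mem _ (single_r_mem_FH i) c,
        0, zero_mem _, by simp⟩
    | sr i =>
      refine ⟨0, zero_mem _, c • MonoidAlgebra.single (r (-i)) 1,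
        Subalgebra.smul_mem _ (single_r_mem_FH _) c,
        by simp [reflv, MonoidAlgebra.single_mul_single]⟩

lemma coeff_sr_of_mem_FH {a : FG F n} (ha : a ∈ FH F n) (i : ZMod n) : a.coeff (sr i) = 0 := by
  induction ha using FH_induction with
  | zero => simp
  | add x y _ _ hx hy => simp [hx, hy]
  | smul c x _ hx => simp [hx]
  | single j => simp

lemma eq_zero_of_add_mul_reflv {a b : FG F n} (ha : a ∈ FH F n) (hb : b ∈ FH F n)
    (h : a + b * reflv F n = 0) : a = 0 ∧ b = 0 := by
  have key : ∀ c ∈ FH F n, ∀ i, (c * reflv F n).coeff (r i) = 0 := by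
    intro c hc i
    simp [reflv, coeff_sr_of_mem_FH hc]
  have ha0 : a = 0 := by
    ext x
    cases x with
    | r i => simpa [key b hb] using congrArg (fun y => y.coeff (r i)) h
    | sr i => simpa using coeff_sr_of_mem_FH ha i
  subst ha0
  refine ⟨rfl, ?_⟩
  have := congrArg (· * reflv F n) h
  simpa [mul_assoc, reflv_mul_reflv] using this

/-- Conjugation by `v` is `bar` on the commutative algebra `FH`, so the `bar`-fixed elements of `FH`
commute with `FH` and with `v`. All central elements used below arise in this way. -/
lemma commute_of_bar_eq {a : FG F n} (ha : a ∈ FH F n) (hbar : bar a = a) (x : FG F n) :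
    Commute a x := by
  obtain ⟨c, hc, d, hd, rfl⟩ := exists_eq_add_mul_reflv x
  have h1 := FH_mul_comm ha hc
  have h2 : a * (d * reflv F n) = d * reflv F n * a := by
    rw [mul_assoc, reflv_mul ha, hbar, ← mul_assoc, ← mul_assoc, FH_mul_comm ha hd]
  rw [commute_iff_eq, mul_add, add_mul, h1, h2]

variable [CharP F 2]

lemma FG_add_self (x : FG F n) : x + x = 0 := by
  rw [← two_smul F x, show (2 : F) = 0 from CharTwo.two_eq_zero, zero_smul]

lemma FG_neg (x : FG F n) : -x = x := by
  rw [neg_eq_iff_add_eq_zero, FG_add_self]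

lemma FG_sub (x y : FG F n) : x - y = x + y := by rw [sub_eq_add_neg, FG_neg]

/-- The symplectic involution `bar`: norms `x * bar x` are central. -/
lemma exists_mul_bar (x : FG F n) : ∃ z ∈ FH F n, bar z = z ∧ x * bar x = z ∧ bar x * x = z := by
  obtain ⟨a, ha, b, hb, rfl⟩ := exists_eq_add_mul_reflv x
  have ha' := bar_mem_FH ha
  have hb' := bar_mem_FH hb
  -- `bar` fixes `b v`. Both cross terms of the norm therefore equal `a` (or `bar a`) times `b v`,
  -- and they cancel in characteristic 2.
  have e : bar (a + b * reflv F n) = bar a + b * reflv F n := by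
    rw [bar_add, bar_mul, bar_reflv, reflv_mul hb', bar_bar]
  refine ⟨a * bar a + b * bar b, add_mem (mul_mem ha ha') (mul_mem hb hb'), ?_, ?_, ?_⟩
  · rw [bar_add, bar_mul, bar_mul, bar_bar, bar_bar]
  · have h1 : b * reflv F n * bar a = a * (b * reflv F n) := by
      rw [mul_assoc, reflv_mul ha', bar_bar, ← mul_assoc, ← mul_assoc, FH_mul_comm ha hb]
    have h2 : b * reflv F n * (b * reflv F n) = b * bar b := by
      rw [mul_assoc, ← mul_assoc _ b, reflv_mul hb, mul_assoc (bar b), reflv_mul_reflv, mul_one]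
    rw [e, add_mul, mul_add, mul_add, h1, h2, ← add_assoc, add_assoc (a * bar a), FG_add_self, add_zero]
  · have h1 : b * reflv F n * a = bar a * (b * reflv F n) := by
      rw [mul_assoc, reflv_mul ha, ← mul_assoc, ← mul_assoc, FH_mul_comm ha' hb]
    have h2 : b * reflv F n * (b * reflv F n) = b * bar b := by
      rw [mul_assoc, ← mul_assoc _ b, reflv_mul hb, mul_assoc (bar b), reflv_mul_reflv, mul_one]
    rw [e, add_mul, mul_add, mul_add, h1, h2, ← add_assoc, add_assoc (bar a * a), FG_add_self, add_zero,
      FH_mul_comm ha' ha]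

lemma exists_add_bar (x : FG F n) : ∃ z ∈ FH F n, bar z = z ∧ x + bar x = z := by
  obtain ⟨a, ha, b, hb, rfl⟩ := exists_eq_add_mul_reflv x
  refine ⟨a + bar a, add_mem ha (bar_mem_FH ha), by rw [bar_add, bar_bar, add_comm], ?_⟩
  rw [bar_add, bar_mul, bar_reflv, reflv_mul (bar_mem_FH hb), bar_bar, add_add_add_comm, FG_add_self,
    add_zero]

end Dihedral

/-! ### Primitive idempotents of `FH` and the block decomposition of 1 -/

section Idempotents
variable {F : Type u} [Field F] {n : ℕ}

/-- Minimality of the ideal says that the corner `FH e` is a field: each `e * a` is zero or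
invertible relative to `e`. -/
lemma isPrimitive_iff {e : FG F n} : IsPrimitiveIdempotentFH F n e ↔
    e ∈ FH F n ∧ e * e = e ∧ e ≠ 0 ∧ ∀ a ∈ FH F n, e * a = 0 ∨ ∃ b ∈ FH F n, e * a * b = e := by
  constructor
  · rintro ⟨f, rfl, hf, hat⟩
    refine ⟨f.2, congrArg Subtype.val hf, ?_, ?_⟩
    · intro h
      have : f = 0 := Subtype.ext h
      exact hat.1 (by simp [this])
    · intro a ha
      have hle : Ideal.span {(⟨a, ha⟩ * f : FH F n)} ≤ Ideal.span {f} := by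
        rw [Ideal.span_singleton_le_iff_mem]
        exact Ideal.mul_mem_left _ _ (Ideal.mem_span_singleton_self f)
      rcases hat.le_iff.1 hle with h | h
      · left
        rw [Ideal.span_singleton_eq_bot] at h
        rw [FH_mul_comm f.2 ha]
        exact congrArg Subtype.val h
      · right
        have hm : f ∈ Ideal.span {(⟨a, ha⟩ * f : FH F n)} := by
          rw [h]; exact Ideal.mem_span_singleton_self f
        obtain ⟨b, hb⟩ := Submodule.mem_span_singleton.1 hm
        refine ⟨b, b.2, ?_⟩
        have := congrArg Subtype.val hb
        rw [FH_mul_comm f.2 ha, FH_mul_comm (mul_mem ha f.2) b.2]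
        exact this
  · rintro ⟨he, hi, h0, h⟩
    refine ⟨⟨e, he⟩, rfl, Subtype.ext hi, ?_, ?_⟩
    · intro hb
      rw [Ideal.span_singleton_eq_bot] at hb
      exact h0 (congrArg Subtype.val hb)
    · intro J hJ
      by_contra hne
      obtain ⟨x, hx, hx0⟩ := Submodule.exists_mem_ne_zero_of_ne_bot hne
      obtain ⟨a, rfl⟩ := Submodule.mem_span_singleton.1 (hJ.le hx)
      rcases h a a.2 with h1 | ⟨b, hb, h1⟩
      · apply hx0
        ext1
        rw [FH_mul_comm he a.2] at h1
        exact h1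
      · apply hJ.not_ge
        rw [Ideal.span_singleton_le_iff_mem]
        have : (⟨e, he⟩ : FH F n) = ⟨b, hb⟩ * (a • ⟨e, he⟩) := by
          ext1
          rw [FH_mul_comm he a.2, FH_mul_comm (mul_mem a.2 he) hb] at h1
          exact h1.symm
        rw [this]
        exact J.mul_mem_left _ hx

lemma IsPrimitiveIdempotentFH.bar {e : FG F n} (h : IsPrimitiveIdempotentFH F n e) :
    IsPrimitiveIdempotentFH F n (bar e) := by
  rw [isPrimitive_iff] at h ⊢
  obtain ⟨he, hi, h0, h⟩ := h
  refine ⟨bar_mem_FH he, by rw [← bar_mul, hi], fun h => h0 (bar_injective (h.trans bar_zero.symm)), ?_⟩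
  intro a ha
  rcases h _ (bar_mem_FH ha) with h | ⟨b, hb, h⟩
  · left
    rw [← bar_bar a, ← bar_mul_of_mem_FH he (bar_mem_FH ha), h, bar_zero]
  · right
    refine ⟨DihedralCode.bar b, bar_mem_FH hb, ?_⟩
    nth_rewrite 2 [← h]
    rw [bar_mul_of_mem_FH (mul_mem he (bar_mem_FH ha)) hb,
      bar_mul_of_mem_FH he (bar_mem_FH ha), bar_bar]

/-- If `e f ≠ 0`, then `e f` is invertible in both corners, whence `e f = e` and `e f = f`. -/
lemma IsPrimitiveIdempotentFH.mul_eq_zero {e f : FG F n} (he : IsPrimitiveIdempotentFH F n e)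
    (hf : IsPrimitiveIdempotentFH F n f) (hne : e ≠ f) : e * f = 0 := by
  rw [isPrimitive_iff] at he hf
  obtain ⟨he, hei, -, h1⟩ := he
  obtain ⟨hf, hfi, -, h2⟩ := hf
  by_contra hef
  obtain ⟨b, hb, h1⟩ := (h1 f hf).resolve_left hef
  obtain ⟨c, hc, h2⟩ := (h2 e he).resolve_left (by rwa [FH_mul_comm hf he])
  have e1 : e * f = e := by
    rw [← h1, mul_assoc, FH_mul_comm hb hf, mul_assoc, ← mul_assoc f f, hfi, ← mul_assoc]
  have e2 : f * e = f := by
    rw [← h2, mul_assoc, FH_mul_comm hc he, mul_assoc, ← mul_assoc e e, hei, ← mul_assoc]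
  exact hne (by rw [← e1, FH_mul_comm he hf, e2])

lemma e0_eq [NeZero n] : e0 F n = (n : F)⁻¹ • ∑ i : ZMod n, MonoidAlgebra.single (r i) 1 := by
  rw [e0]
  congr 1
  simp only [rot_pow]
  obtain ⟨k, rfl⟩ := Nat.exists_eq_succ_of_ne_zero (NeZero.ne n)
  rw [← Fin.sum_univ_eq_sum_range (fun i => (MonoidAlgebra.single (r (i : ZMod (k + 1))) 1 : FG F (k + 1)))]
  refine Finset.sum_congr rfl fun i _ => ?_
  congr 2
  exact Fin.cast_val_eq_self i

lemma coeff_e0_r [NeZero n] (i : ZMod n) : (e0 F n).coeff (r i) = (n : F)⁻¹ := by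
  classical
  simp [e0_eq, Finsupp.single_apply]

lemma e0_mem_FH : e0 F n ∈ FH F n :=
  Subalgebra.smul_mem _ (sum_mem fun _ _ => pow_mem rot_mem_FH _) _

lemma bar_e0 [NeZero n] : bar (e0 F n) = e0 F n := by
  rw [e0_eq, bar_smul, bar_sum]
  congr 1
  simp only [bar_single, inv_r]
  exact Equiv.sum_comp (Equiv.neg (ZMod n)) fun i => (MonoidAlgebra.single (r i) 1 : FG F n)

lemma single_mul_e0 [NeZero n] (i : ZMod n) : MonoidAlgebra.single (r i) 1 * e0 F n = e0 F n := by
  rw [e0_eq, mul_smul_comm, Finset.mul_sum]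
  congr 1
  simp only [MonoidAlgebra.single_mul_single, r_mul_r, mul_one]
  exact Equiv.sum_comp (Equiv.addLeft i) fun i => (MonoidAlgebra.single (r i) 1 : FG F n)

lemma exists_mul_e0 [NeZero n] {a : FG F n} (ha : a ∈ FH F n) : ∃ c : F, a * e0 F n = c • e0 F n := by
  induction ha using FH_induction with
  | zero => exact ⟨0, by simp⟩
  | add x y _ _ hx hy =>
    obtain ⟨c, hc⟩ := hx
    obtain ⟨d, hd⟩ := hy
    exact ⟨c + d, by rw [add_mul, hc, hd, add_smul]⟩
  | smul c x _ hx =>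
    obtain ⟨d, hd⟩ := hx
    exact ⟨c * d, by rw [smul_mul_assoc, hd, smul_smul]⟩
  | single i => exact ⟨1, by rw [single_mul_e0, one_smul]⟩

lemma e0_mul_e0 [NeZero n] (hn : (n : F) ≠ 0) : e0 F n * e0 F n = e0 F n := by
  nth_rewrite 1 [e0_eq]
  rw [smul_mul_assoc, Finset.sum_mul]
  simp only [single_mul_e0, Finset.sum_const, Finset.card_univ, ZMod.card]
  rw [← Nat.cast_smul_eq_nsmul F, smul_smul, inv_mul_cancel₀ hn, one_smul]

lemma e0_ne_zero [NeZero n] (hn : (n : F) ≠ 0) : e0 F n ≠ 0 := by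
  intro h
  have := coeff_e0_r (F := F) (n := n) 0
  rw [h] at this
  exact hn (inv_eq_zero.1 this.symm)

lemma isPrimitive_e0 [NeZero n] (hn : (n : F) ≠ 0) : IsPrimitiveIdempotentFH F n (e0 F n) := by
  rw [isPrimitive_iff]
  refine ⟨e0_mem_FH, e0_mul_e0 hn, e0_ne_zero hn, fun a ha => ?_⟩
  obtain ⟨c, hc⟩ := exists_mul_e0 ha
  rw [FH_mul_comm e0_mem_FH ha, hc]
  by_cases h : c = 0
  · left; rw [h, zero_smul]
  · right
    refine ⟨c⁻¹ • 1, Subalgebra.smul_mem _ (one_mem _) _, ?_⟩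
    rw [mul_smul_comm, mul_one, smul_smul, inv_mul_cancel₀ h, one_smul]

lemma block_mem_FH {ε : FG F n} (h : ε ∈ blockIds F n) : ε ∈ FH F n := by
  obtain ⟨e, he, -, ⟨-, rfl⟩ | ⟨-, rfl⟩⟩ := h
  · exact add_mem (isPrimitive_iff.1 he).1 (bar_mem_FH (isPrimitive_iff.1 he).1)
  · exact (isPrimitive_iff.1 he).1

lemma bar_block {ε : FG F n} (h : ε ∈ blockIds F n) : bar ε = ε := by
  obtain ⟨e, he, -, ⟨-, rfl⟩ | ⟨h, rfl⟩⟩ := h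
  · rw [bar_add, bar_bar, add_comm]
  · exact h

lemma block_commute {ε : FG F n} (h : ε ∈ blockIds F n) (x : FG F n) : Commute ε x :=
  commute_of_bar_eq (block_mem_FH h) (bar_block h) x

/-- Every block identity is the identity for the primitive idempotent it comes from. -/
lemma exists_primitive_mul_block {ε : FG F n} (h : ε ∈ blockIds F n) :
    ∃ e, IsPrimitiveIdempotentFH F n e ∧ e ≠ e0 F n ∧ e * ε = e ∧
      ((bar e ≠ e ∧ ε = e + bar e) ∨ (bar e = e ∧ ε = e)) := by
  obtain ⟨e, he, h0, ⟨h, rfl⟩ | ⟨h, rfl⟩⟩ := h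
  · refine ⟨e, he, h0, ?_, Or.inl ⟨h, rfl⟩⟩
    rw [mul_add, (isPrimitive_iff.1 he).2.1, he.mul_eq_zero he.bar h.symm, add_zero]
  · exact ⟨ε, he, h0, (isPrimitive_iff.1 he).2.1, Or.inr ⟨h, rfl⟩⟩

lemma block_mul_self {ε : FG F n} (h : ε ∈ blockIds F n) : ε * ε = ε := by
  obtain ⟨e, he, h0, hm, ⟨h', rfl⟩ | ⟨h', hε⟩⟩ := exists_primitive_mul_block h
  · have : bar e * (e + bar e) = bar e := by
      rw [mul_add, (isPrimitive_iff.1 he.bar).2.1, he.bar.mul_eq_zero he h', zero_add]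
    rw [add_mul, hm, this]
  · rwa [← hε] at hm

lemma block_ne_zero {ε : FG F n} (h : ε ∈ blockIds F n) : ε ≠ 0 := by
  rintro rfl
  obtain ⟨e, he, h0, hm, -⟩ := exists_primitive_mul_block h
  exact (isPrimitive_iff.1 he).2.2.1 (by rw [← hm, mul_zero])

lemma e0_mul_block [NeZero n] (hn : (n : F) ≠ 0) {ε : FG F n} (h : ε ∈ blockIds F n) :
    e0 F n * ε = 0 := by
  obtain ⟨e, he, h0, hm, ⟨h', rfl⟩ | ⟨h', rfl⟩⟩ := exists_primitive_mul_block h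
  · have h1 : bar e ≠ e0 F n := fun h => h0 (by rw [← bar_bar e, h, bar_e0])
    rw [mul_add, (isPrimitive_e0 hn).mul_eq_zero he h0.symm,
      (isPrimitive_e0 hn).mul_eq_zero he.bar h1.symm, add_zero]
  · exact (isPrimitive_e0 hn).mul_eq_zero he h0.symm

lemma block_mul_block {ε ε' : FG F n} (h : ε ∈ blockIds F n) (h' : ε' ∈ blockIds F n)
    (hne : ε ≠ ε') : ε * ε' = 0 := by
  obtain ⟨e, he, -, hm, hc⟩ := exists_primitive_mul_block h
  obtain ⟨f, hf, -, hm', hc'⟩ := exists_primitive_mul_block h'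
  have h1 : e ≠ f := by
    rintro rfl
    apply hne
    rcases hc with ⟨h1, rfl⟩ | ⟨h1, rfl⟩ <;> rcases hc' with ⟨h2, rfl⟩ | ⟨h2, rfl⟩ <;> first | rfl | exact absurd h2 h1 | exact absurd h1 h2
  have h2 : e ≠ bar f := by
    rintro rfl
    apply hne
    rw [bar_bar] at hc
    rcases hc with ⟨h1, rfl⟩ | ⟨h1, rfl⟩ <;> rcases hc' with ⟨h2, rfl⟩ | ⟨h2, rfl⟩
    · exact add_comm _ _
    · exact absurd h2.symm h1
    · exact absurd h1.symm h2
    · exact h1.symm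
  have k1 := he.mul_eq_zero hf h1
  have k2 := he.mul_eq_zero hf.bar h2
  have k3 : bar e * f = 0 := he.bar.mul_eq_zero hf fun h => h2 (by rw [← h, bar_bar])
  have k4 : bar e * bar f = 0 := he.bar.mul_eq_zero hf.bar fun h => h1 (bar_injective h)
  rcases hc with ⟨-, rfl⟩ | ⟨-, rfl⟩ <;> rcases hc' with ⟨-, rfl⟩ | ⟨-, rfl⟩ <;>
    simp [add_mul, mul_add, k1, k2, k3, k4]

/-- Maschke's theorem for the cyclic group `H`, whose order `n` is invertible in `F`. -/
lemma isSemisimpleRing_FH [NeZero n] (hn : (n : F) ≠ 0) : IsSemisimpleRing (FH F n) := by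
  let H := Subgroup.zpowers (r 1 : DihedralGroup n)
  have hc : Nat.card H = n := by rw [Nat.card_zpowers, orderOf_r_one]
  have : NeZero (Nat.card H : F) := ⟨by rwa [hc]⟩
  have : Finite H := Subgroup.instFiniteSubtypeMem _
  let f := MonoidAlgebra.mapDomainAlgHom F F H.subtype
  have hf : Function.Injective f :=
    MonoidAlgebra.mapDomain_injective Subtype.val_injective
  have : IsSemisimpleRing (MonoidAlgebra F H) := inferInstance
  exact ((AlgEquiv.ofInjective f hf).toRingEquiv).isSemisimpleRing

/-- A nonzero `s` generates an ideal containing a minimal one, which by semisimplicity is generated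
by a primitive idempotent `f = a s`. As `s` is idempotent, `f = f s = 0`, a contradiction. -/
lemma eq_zero_of_primitive_mul [NeZero n] (hn : (n : F) ≠ 0) {s : FG F n} (hs : s ∈ FH F n)
    (h : ∀ e, IsPrimitiveIdempotentFH F n e → e * s = 0) (hi : s * s = s) : s = 0 := by
  have := isSemisimpleRing_FH hn
  by_contra h0
  have hne : Ideal.span {(⟨s, hs⟩ : FH F n)} ≠ ⊥ := by
    rw [Ne, Ideal.span_singleton_eq_bot]
    exact fun h => h0 (congrArg Subtype.val h)
  obtain ⟨J, hJ, hle⟩ := (IsAtomic.eq_bot_or_exists_atom_le _).resolve_left hne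
  obtain ⟨f, hf, rfl⟩ := IsSemisimpleRing.ideal_eq_span_idempotent J
  have hp : IsPrimitiveIdempotentFH F n (f : FG F n) := ⟨f, rfl, hf, hJ⟩
  obtain ⟨a, ha⟩ := Submodule.mem_span_singleton.1 (hle (Ideal.mem_span_singleton_self f))
  have ha' : (a : FG F n) * s = f := congrArg Subtype.val ha
  apply (isPrimitive_iff.1 hp).2.2.1
  rw [← ha', ← hi, ← mul_assoc, ha', h _ hp]

/-- The difference of the two sides is an idempotent of `FH` annihilated by every primitive
idempotent, since each of these is absorbed by `e₀` or by one block identity. -/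
lemma block_sum [NeZero n] (hn : (n : F) ≠ 0) [Fintype (blockIds F n)] :
    e0 F n + ∑ ε : blockIds F n, (ε : FG F n) = 1 := by
  classical
  set S := ∑ ε : blockIds F n, (ε : FG F n) with hS
  have hSm : S ∈ FH F n := sum_mem fun ε _ => block_mem_FH ε.2
  have hεS : ∀ ε : blockIds F n, (ε : FG F n) * S = ε := by
    intro ε
    rw [hS, Finset.mul_sum, Finset.sum_eq_single ε]
    · exact block_mul_self ε.2
    · intro b _ hb
      exact block_mul_block ε.2 b.2 fun h => hb (Subtype.ext h.symm)
    · simp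
  have h0S : e0 F n * S = 0 := by
    rw [hS, Finset.mul_sum]
    exact Finset.sum_eq_zero fun ε _ => e0_mul_block hn ε.2
  have hSS : S * S = S := by
    conv_lhs => rw [hS, Finset.sum_mul]
    exact Finset.sum_congr rfl fun ε _ => hεS ε
  have hS0 : S * e0 F n = 0 := by rw [FH_mul_comm hSm e0_mem_FH, h0S]
  have key : 1 - (e0 F n + S) = 0 := by
    apply eq_zero_of_primitive_mul hn (sub_mem (one_mem _) (add_mem e0_mem_FH hSm))
    · intro e he
      rw [mul_sub, mul_one, mul_add]
      by_cases h : e = e0 F n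
      · rw [h, h0S, e0_mul_e0 hn]; abel
      · rw [he.mul_eq_zero (isPrimitive_e0 hn) h, zero_add]
        have : ∃ ε : blockIds F n, e * (ε : FG F n) = e := by
          by_cases hb : bar e = e
          · exact ⟨⟨e, e, he, h, Or.inr ⟨hb, rfl⟩⟩, (isPrimitive_iff.1 he).2.1⟩
          · refine ⟨⟨e + bar e, e, he, h, Or.inl ⟨hb, rfl⟩⟩, ?_⟩
            rw [mul_add, (isPrimitive_iff.1 he).2.1, he.mul_eq_zero he.bar (Ne.symm hb), add_zero]
        obtain ⟨ε, hε⟩ := this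
        rw [← hε, mul_assoc, hεS, sub_self]
    · have : (e0 F n + S) * (e0 F n + S) = e0 F n + S := by
        rw [add_mul, mul_add, mul_add, hSS, h0S, hS0, e0_mul_e0 hn, add_zero, zero_add]
      rw [mul_sub, mul_one, sub_mul, one_mul, this, sub_self, sub_zero]
  exact (sub_eq_zero.1 key).symm

lemma rot_mul_block_ne [NeZero n] (hn : (n : F) ≠ 0) {ε : FG F n} (h : ε ∈ blockIds F n) :
    rot F n * ε ≠ ε := by
  intro hr
  have hp : ∀ k : ℕ, rot F n ^ k * ε = ε := by
    intro k
    induction k with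
    | zero => simp
    | succ k ih => rw [pow_succ, mul_assoc, hr, ih]
  have : e0 F n * ε = ε := by
    rw [e0, smul_mul_assoc, Finset.sum_mul]
    simp only [hp, Finset.sum_const, Finset.card_range]
    rw [← Nat.cast_smul_eq_nsmul F, smul_smul, inv_mul_cancel₀ hn, one_smul]
  exact block_ne_zero h (this.symm.trans (e0_mul_block hn h))

lemma rot_pow_card : rot F n ^ n = 1 := by
  rw [rot_pow]; simp [MonoidAlgebra.one_def]

lemma bar_rot_mul_rot : bar (rot F n) * rot F n = 1 := by
  rw [rot, MonoidAlgebra.of_apply, bar_single]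
  simp [MonoidAlgebra.single_mul_single, MonoidAlgebra.one_def]

/-- Otherwise `u² ε = ε`, and as `u` has odd order, `u ε = ε`; then `e₀ ε = ε`, against
orthogonality. Thus `bar` acts nontrivially on `FH ε`. -/
lemma bar_rot_mul_block_ne [NeZero n] (hn : (n : F) ≠ 0) (hodd : Odd n) {ε : FG F n}
    (h : ε ∈ blockIds F n) : bar (rot F n * ε) ≠ rot F n * ε := by
  intro hb
  rw [bar_mul, bar_block h, (block_commute h _).eq] at hb
  have h2 : rot F n ^ 2 * ε = ε := by
    rw [pow_two, mul_assoc, ← hb, ← mul_assoc, FH_mul_comm rot_mem_FH (bar_mem_FH rot_mem_FH),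
      bar_rot_mul_rot, one_mul]
  have hp : ∀ k : ℕ, rot F n ^ (2 * k) * ε = ε := by
    intro k
    induction k with
    | zero => simp
    | succ k ih => rw [mul_add, mul_one, pow_add, mul_assoc, h2, ih]
  obtain ⟨k, hk⟩ := hodd
  have h3 : rot F n * (rot F n ^ (2 * k) * ε) = ε := by
    rw [← mul_assoc, ← pow_succ', ← hk, rot_pow_card, one_mul]
  rw [hp] at h3
  exact rot_mul_block_ne hn h h3

end Idempotents

/-! ### The blocks as matrix algebras over their centres -/

section BlockField
variable {F : Type u} [Field F] {n : ℕ}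

/-- The centre of the block `FG ε`: the elements of `FH ε` fixed by `bar`. -/
def blockCenter (ε : blockIds F n) : NonUnitalSubalgebra F (FG F n) where
  carrier := {x | x ∈ FH F n ∧ bar x = x ∧ x * (ε : FG F n) = x}
  add_mem' := by
    rintro x y ⟨h1, h2, h3⟩ ⟨k1, k2, k3⟩
    exact ⟨add_mem h1 k1, by rw [bar_add, h2, k2], by rw [add_mul, h3, k3]⟩
  zero_mem' := ⟨zero_mem _, bar_zero, zero_mul _⟩
  mul_mem' := by
    rintro x y ⟨h1, h2, h3⟩ ⟨k1, k2, k3⟩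
    exact ⟨mul_mem h1 k1, by rw [bar_mul_of_mem_FH h1 k1, h2, k2], by rw [mul_assoc, k3]⟩
  smul_mem' := by
    rintro c x ⟨h1, h2, h3⟩
    exact ⟨Subalgebra.smul_mem _ h1 c, by rw [bar_smul, h2], by rw [smul_mul_assoc, h3]⟩

/-- The centre of a block as a type. -/
def BlockField (ε : blockIds F n) : Type u := blockCenter ε

namespace BlockField
variable {ε : blockIds F n}

/-- The inclusion of the centre of a block. -/
def val (x : BlockField ε) : FG F n := Subtype.val x

lemma val_injective : Function.Injective (val (ε := ε)) := Subtype.val_injective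

lemma mem_FH (x : BlockField ε) : x.val ∈ FH F n := x.2.1

lemma bar_val (x : BlockField ε) : bar x.val = x.val := x.2.2.1

lemma val_mul_block (x : BlockField ε) : x.val * (ε : FG F n) = x.val := x.2.2.2

instance : NonUnitalRing (BlockField ε) := inferInstanceAs (NonUnitalRing (blockCenter ε))

instance : One (BlockField ε) :=
  ⟨⟨ε, block_mem_FH ε.2, bar_block ε.2, block_mul_self ε.2⟩⟩

lemma val_add (x y : BlockField ε) : (x + y).val = x.val + y.val := rfl
lemma val_mul (x y : BlockField ε) : (x * y).val = x.val * y.val := rfl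
lemma val_zero : (0 : BlockField ε).val = 0 := rfl
lemma val_one : (1 : BlockField ε).val = ε := rfl

instance : CommRing (BlockField ε) :=
  { (inferInstance : NonUnitalRing (BlockField ε)), (inferInstance : One (BlockField ε)) with
    one_mul := fun x => val_injective (by
      rw [val_mul, val_one, FH_mul_comm (block_mem_FH ε.2) x.mem_FH, x.val_mul_block])
    mul_one := fun x => val_injective (by rw [val_mul, val_one, x.val_mul_block])
    mul_comm := fun x y => val_injective (by
      rw [val_mul, val_mul, FH_mul_comm x.mem_FH y.mem_FH]) }

instance : Module F (BlockField ε) := inferInstanceAs (Module F (blockCenter ε))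

lemma val_smul (c : F) (x : BlockField ε) : (c • x).val = c • x.val := rfl

/-- Inversion takes place in the field `FH e`, giving `e b`. If `bar e ≠ e`, adding the `bar`-image
gives the inverse in `FH (e + bar e)`; if `bar e = e`, uniqueness of inverses shows that `e b` is
already fixed by `bar`. -/
lemma isField : IsField (BlockField ε) where
  exists_pair_ne := ⟨0, 1, fun h => block_ne_zero ε.2 (congrArg val h).symm⟩
  mul_comm := mul_comm
  mul_inv_cancel := by
    intro z hz
    obtain ⟨e, he, h0, hm, hc⟩ := exists_primitive_mul_block ε.2
    obtain ⟨heF, hei, -, hinv⟩ := isPrimitive_iff.1 he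
    have hz0 : z.val ≠ 0 := fun h => hz (val_injective (h.trans val_zero.symm))
    have hze : e * z.val ≠ 0 := by
      intro h
      apply hz0
      have hb : bar e * z.val = 0 := by
        rw [← z.bar_val, ← bar_mul_of_mem_FH heF z.mem_FH, h, bar_zero]
      rw [← z.val_mul_block, FH_mul_comm z.mem_FH (block_mem_FH ε.2)]
      rcases hc with ⟨-, hε⟩ | ⟨-, hε⟩
      · rw [hε, add_mul, h, hb, add_zero]
      · rw [hε, h]
    obtain ⟨b, hb, hzb⟩ := (hinv z.val z.mem_FH).resolve_left hze
    have hebF := mul_mem heF hb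
    have h1 : z.val * (e * b) = e := by rw [← mul_assoc, FH_mul_comm z.mem_FH heF, hzb]
    have h2 : z.val * bar (e * b) = bar e := by
      rw [← z.bar_val, ← bar_mul_of_mem_FH z.mem_FH hebF, h1]
    have hebε : e * b * (ε : FG F n) = e * b := by
      rw [mul_assoc, FH_mul_comm hb (block_mem_FH ε.2), ← mul_assoc, hm]
    have hebε' : bar (e * b) * (ε : FG F n) = bar (e * b) := by
      conv_lhs => rw [← bar_block ε.2, ← bar_mul_of_mem_FH hebF (block_mem_FH ε.2), hebε]
    rcases hc with ⟨-, hε⟩ | ⟨hbar, hε⟩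
    · refine ⟨⟨e * b + bar (e * b), add_mem hebF (bar_mem_FH hebF), ?_, ?_⟩, val_injective ?_⟩
      · rw [bar_add, bar_bar, add_comm]
      · rw [add_mul, hebε, hebε']
      · change z.val * (e * b + bar (e * b)) = (ε : FG F n)
        rw [mul_add, h1, h2, hε]
    · refine ⟨⟨e * b, hebF, ?_, hebε⟩, val_injective ?_⟩
      · have h3 : bar (e * b) * e = bar (e * b) :=
          (congrArg (bar (e * b) * ·) hε).symm.trans hebε'
        calc bar (e * b) = bar (e * b) * (z.val * (e * b)) := by rw [h1, h3]
          _ = z.val * bar (e * b) * (e * b) := by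
            rw [← mul_assoc, FH_mul_comm (bar_mem_FH hebF) z.mem_FH]
          _ = e * b := by rw [h2, hbar, ← mul_assoc, hei]
      · exact h1.trans hε.symm

instance : Field (BlockField ε) := isField.toField

instance : Algebra F (BlockField ε) :=
  Algebra.ofModule (fun c x y => val_injective (by
    rw [val_mul, val_smul, val_smul, val_mul, smul_mul_assoc]))
    (fun c x y => val_injective (by rw [val_mul, val_smul, val_smul, val_mul, mul_smul_comm]))

lemma commute (x : BlockField ε) (y : FG F n) : Commute x.val y :=
  commute_of_bar_eq x.mem_FH x.bar_val y

lemma val_sum {ι : Type*} (s : Finset ι) (f : ι → BlockField ε) :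
    (∑ i ∈ s, f i).val = ∑ i ∈ s, (f i).val := by
  classical
  induction s using Finset.induction_on with
  | empty => rfl
  | insert a s ha ih => rw [Finset.sum_insert ha, Finset.sum_insert ha, val_add, ih]

end BlockField

/-- Compressing by `1 + v` turns elements of `FH` into their traces; `1 + v` serves as a rank one
element, with the trace form as pairing. -/
lemma one_add_reflv_mul_mul {c : FG F n} (hc : c ∈ FH F n) :
    (1 + reflv F n) * c * (1 + reflv F n) = (c + bar c) * (1 + reflv F n) := by
  have h1 : reflv F n * c * reflv F n = bar c := by
    rw [reflv_mul hc, mul_assoc, reflv_mul_reflv, mul_one]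
  rw [add_mul, one_mul, mul_add, mul_one, add_mul c, h1, reflv_mul hc, mul_add, mul_one, add_mul]
  abel

/-- Since `v (1 + v) = 1 + v`, an element `a + b v` acts on `1 + v` from the left as `a + b`, which
lies in `FH`. -/
lemma exists_one_add_reflv_mul_mul (y : FG F n) : ∃ z ∈ FH F n, bar z = z ∧
    (1 + reflv F n) * y * (1 + reflv F n) = z * (1 + reflv F n) := by
  obtain ⟨a, ha, b, hb, rfl⟩ := exists_eq_add_mul_reflv y
  refine ⟨(a + b) + bar (a + b), add_mem (add_mem ha hb) (bar_mem_FH (add_mem ha hb)),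
    by rw [bar_add (a + b), bar_bar, add_comm], ?_⟩
  rw [← one_add_reflv_mul_mul (add_mem ha hb)]
  have : reflv F n * (1 + reflv F n) = 1 + reflv F n := by
    rw [mul_add, mul_one, reflv_mul_reflv, add_comm]
  rw [mul_assoc, mul_assoc, add_mul a, add_mul a, mul_assoc b, this]

variable [CharP F 2]

/-- The trace of `u ε` is nonzero because `n` is odd, hence invertible in the field of central
elements; `θ` is `u ε` divided by its trace. -/
lemma exists_trace_one [NeZero n] (hn : (n : F) ≠ 0) (hodd : Odd n) (ε : blockIds F n) :
    ∃ θ ∈ FH F n, θ * (ε : FG F n) = θ ∧ θ + bar θ = ε := by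
  have hu : rot F n * (ε : FG F n) ∈ FH F n := mul_mem rot_mem_FH (block_mem_FH ε.2)
  have huε : rot F n * (ε : FG F n) * (ε : FG F n) = rot F n * (ε : FG F n) := by
    rw [mul_assoc, block_mul_self ε.2]
  let τ : BlockField ε := ⟨rot F n * (ε : FG F n) + bar (rot F n * (ε : FG F n)),
    add_mem hu (bar_mem_FH hu), by rw [bar_add, bar_bar, add_comm], by
      rw [add_mul, huε]
      congr 1
      conv_lhs => rw [← bar_block ε.2, bar_block ε.2]
      nth_rewrite 2 [← bar_block ε.2]
      rw [← bar_mul_of_mem_FH hu (block_mem_FH ε.2), huε]⟩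
  have hτ : τ ≠ 0 := by
    intro h
    have h' : rot F n * (ε : FG F n) + bar (rot F n * (ε : FG F n)) = 0 := congrArg BlockField.val h
    rw [← FG_sub, sub_eq_zero] at h'
    exact bar_rot_mul_block_ne hn hodd ε.2 h'.symm
  have h1 : τ.val * (τ⁻¹).val = ε := by rw [← BlockField.val_mul, mul_inv_cancel₀ hτ]; rfl
  refine ⟨rot F n * (ε : FG F n) * (τ⁻¹).val, mul_mem hu (BlockField.mem_FH _), ?_, ?_⟩
  · rw [mul_assoc, BlockField.val_mul_block]
  · rw [bar_mul_of_mem_FH hu (BlockField.mem_FH _), BlockField.bar_val, ← add_mul]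
    exact h1

/-- The families `(θ, ε)` and `(ε, bar θ)` are dual for the trace form: `θ` and `bar θ` have trace
`ε`, while `ε` and `bar θ * θ` are fixed by `bar` and have trace 0 in characteristic 2. So the
elements `a i * (1 + v) * b j` form a system of matrix units for the block. -/
lemma exists_matrix_units [NeZero n] (hn : (n : F) ≠ 0) (hodd : Odd n) (ε : blockIds F n) :
    ∃ a b : Fin 2 → FG F n, (∀ i, (ε : FG F n) * a i = a i) ∧ (∀ i, b i * (ε : FG F n) = b i) ∧
      (∀ i j, (1 + reflv F n) * (b i * a j) * (1 + reflv F n) =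
        if i = j then (ε : FG F n) * (1 + reflv F n) else 0) ∧
      ∑ i, a i * (1 + reflv F n) * b i = ε := by
  obtain ⟨θ, hθ, hθε, htr⟩ := exists_trace_one hn hodd ε
  have hε := block_mem_FH ε.2
  have hbθ := bar_mem_FH hθ
  have hbθε : bar θ * (ε : FG F n) = bar θ := by
    nth_rewrite 1 [← bar_block ε.2]
    rw [← bar_mul_of_mem_FH hθ hε, hθε]
  refine ⟨![θ, ε], ![ε, bar θ], ?_, ?_, ?_, ?_⟩
  · intro i
    fin_cases i
    · simpa [hθε] using FH_mul_comm hε hθ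
    · exact block_mul_self ε.2
  · intro i
    fin_cases i
    · exact block_mul_self ε.2
    · exact hbθε
  · intro i j
    have h0 : ∀ x : FG F n, x + x = 0 := FG_add_self
    fin_cases i <;> fin_cases j
    · simp only [Fin.zero_eta, Fin.isValue, Matrix.cons_val_zero, if_true]
      rw [one_add_reflv_mul_mul (mul_mem hε hθ), FH_mul_comm hε hθ, hθε, htr]
    · simp only [Fin.zero_eta, Fin.mk_one, Fin.isValue, Matrix.cons_val_zero, Matrix.cons_val_one]
      rw [one_add_reflv_mul_mul (mul_mem hε hε), block_mul_self ε.2, bar_block ε.2, h0]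
      simp
    · simp only [Fin.zero_eta, Fin.mk_one, Fin.isValue, Matrix.cons_val_zero, Matrix.cons_val_one]
      rw [one_add_reflv_mul_mul (mul_mem hbθ hθ), bar_mul, bar_bar, h0]
      simp
    · simp only [Fin.mk_one, Fin.isValue, Matrix.cons_val_one, if_true]
      change (1 + reflv F n) * (bar θ * ε) * (1 + reflv F n) = _
      rw [one_add_reflv_mul_mul (mul_mem hbθ hε), hbθε, bar_bar, add_comm (bar θ), htr]
  · rw [Fin.sum_univ_two]
    simp only [Fin.isValue, Matrix.cons_val_zero, Matrix.cons_val_one]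
    have h1 : θ * (1 + reflv F n) * ε = θ + θ * reflv F n := by
      rw [mul_assoc, ← (block_commute ε.2 _).eq, ← mul_assoc, hθε, mul_add, mul_one]
    have h2 : (ε : FG F n) * (1 + reflv F n) * bar θ = bar θ + θ * reflv F n := by
      rw [mul_assoc, (block_commute ε.2 _).eq, mul_assoc, hbθε, add_mul, one_mul, reflv_mul hbθ, bar_bar]
    rw [h1, h2, add_add_add_comm, FG_add_self, add_zero, htr]

lemma exists_matrix_hom [NeZero n] (hn : (n : F) ≠ 0) (hodd : Odd n) (ε : blockIds F n) :
    ∃ φ : Matrix (Fin 2) (Fin 2) (BlockField ε) →ₙₐ[F] FG F n, Function.Injective φ ∧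
      Set.range φ = {x | ∃ a : FG F n, x = a * ε} := by
  obtain ⟨a, b, ha, hb, hab, hsum⟩ := exists_matrix_units hn hodd ε
  set s : FG F n := 1 + reflv F n with hs
  obtain ⟨E, hE⟩ : ∃ E : Fin 2 → Fin 2 → FG F n, ∀ i j, E i j = a i * s * b j :=
    ⟨_, fun _ _ => rfl⟩
  have hEE : ∀ i j k l, E i j * E k l = if j = k then E i l else 0 := by
    intro i j k l
    have : E i j * E k l = a i * (s * (b j * a k) * s) * b l := by simp only [hE, mul_assoc]
    rw [this, hab]
    split_ifs with h
    · rw [← mul_assoc, ← (block_commute ε.2 (a i)).eq, ha, hE]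
    · simp
  have hεE : ∀ i j, (ε : FG F n) * E i j = E i j := fun i j => by
    simp only [hE]; rw [← mul_assoc, ← mul_assoc, ha]
  let φ : Matrix (Fin 2) (Fin 2) (BlockField ε) →ₙₐ[F] FG F n :=
    { toFun := fun M => ∑ i, ∑ j, (M i j).val * E i j
      map_smul' := fun c M => by
        simp [BlockField.val_smul]
      map_zero' := by simp [BlockField.val_zero]
      map_add' := fun M N => by
        simp [BlockField.val_add, add_mul, Finset.sum_add_distrib]
      map_mul' := fun M N => by
        have key : ∀ i j k l, (M i j).val * E i j * ((N k l).val * E k l) =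
            if j = k then (M i j * N k l).val * E i l else 0 := by
          intro i j k l
          rw [mul_assoc, ← mul_assoc (E i j), ← ((N k l).commute _).eq, mul_assoc, hEE,
            BlockField.val_mul]
          split_ifs <;> simp [mul_assoc]
        simp only [Finset.sum_mul, Finset.mul_sum, key, Matrix.mul_apply, BlockField.val_sum]
        simp [Fin.sum_univ_two]
        abel }
  have hφ : ∀ M, φ M = ∑ i, ∑ j, (M i j).val * E i j := fun _ => rfl
  refine ⟨φ, ?_, ?_⟩
  · rw [injective_iff_map_eq_zero]
    intro M hM
    ext1 i j
    have hk : ∀ k, (M i j).val * E k k = 0 := by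
      intro k
      -- Multiplying by matrix units moves the `(i, j)` entry to the `k`-th diagonal place; the sum
      -- over `k` of these places is `ε`, which recovers the entry.
      have h1 : E k i * φ M * E j k = (M i j).val * E k k := by
        have h2 : ∀ p q, E k i * ((M p q).val * E p q) * E j k =
            if i = p then if q = j then (M p q).val * E k k else 0 else 0 := by
          intro p q
          rw [← mul_assoc (E k i), ← ((M p q).commute (E k i)).eq, mul_assoc, mul_assoc, ← mul_assoc (E k i), hEE]
          split_ifs with h h'
          · rw [hEE, if_pos h']
          · rw [hEE, if_neg h', mul_zero]
          · simp
        rw [hφ, Finset.mul_sum, Finset.sum_mul]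
        simp only [Finset.mul_sum, Finset.sum_mul, h2]
        simp
      rw [← h1, hM]; simp
    apply BlockField.val_injective
    rw [← BlockField.val_mul_block, ← hsum, Finset.mul_sum]
    exact Finset.sum_eq_zero fun k _ => by rw [← hE, hk]
  · ext y
    constructor
    · rintro ⟨M, rfl⟩
      refine ⟨φ M, ?_⟩
      rw [← (block_commute ε.2 _).eq, hφ]
      simp only [Finset.mul_sum]
      refine Finset.sum_congr rfl fun i _ => Finset.sum_congr rfl fun j _ => ?_
      rw [← mul_assoc, (block_commute ε.2 (M i j).val).eq, mul_assoc, hεE]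
    · rintro ⟨x, rfl⟩
      set y := x * (ε : FG F n) with hy
      have hyε : y * ε = y := by rw [hy, mul_assoc, block_mul_self ε.2]
      have hεy : ε * y = y := by rw [(block_commute ε.2 _).eq, hyε]
      -- The `(i, j)` entry of the preimage of `y`: `E i i * y * E j j` contains the compression of
      -- `b i * y * a j`, so it is a central multiple of `E i j`.
      choose z hzF hzb hz using fun i j => exists_one_add_reflv_mul_mul (b i * y * a j)
      refine ⟨Matrix.of fun i j => ⟨z i j * ε, mul_mem (hzF i j) (block_mem_FH ε.2), ?_, ?_⟩, ?_⟩
      · rw [bar_mul_of_mem_FH (hzF i j) (block_mem_FH ε.2), hzb, bar_block ε.2]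
      · rw [mul_assoc, block_mul_self ε.2]
      · rw [hφ]
        have h1 : ∀ i j, z i j * ε * E i j = E i i * y * E j j := by
          intro i j
          have h2 : E i i * y * E j j = a i * (s * (b i * y * a j) * s) * b j := by
            simp only [hE, mul_assoc]
          rw [mul_assoc, hεE, h2, hz]
          simp only [hE]
          rw [← mul_assoc, ← mul_assoc, ← mul_assoc,
            (commute_of_bar_eq (hzF i j) (hzb i j) (a i)).eq]
        change ∑ i, ∑ j, z i j * ε * E i j = y
        simp only [h1, ← Finset.mul_sum, ← Finset.sum_mul]
        simp only [hE, hsum]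
        rw [hεy, hyε]

/-- Over a finite field the matrix algebra `M₂` contains a quadratic field extension. -/
lemma exists_quadratic_subfield (L : Type u) [Field L] [Finite L] [CharP L 2] :
    ∃ E : Subalgebra L (Matrix (Fin 2) (Fin 2) L), IsField E ∧ Module.finrank L E = 2 := by
  have hfr : Module.finrank L (FiniteField.Extension L 2 2) = 2 :=
    FiniteField.finrank_extension ..
  -- The quadratic extension acts faithfully on itself by multiplication.
  let b := Module.finBasisOfFinrankEq L (FiniteField.Extension L 2 2) hfr
  let f := Algebra.leftMulMatrix b
  let e := AlgEquiv.ofInjective f (Algebra.leftMulMatrix_injective b)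
  refine ⟨f.range, ?_, ?_⟩
  · exact e.symm.toMulEquiv.isField (Field.toIsField _)
  · rw [← e.toLinearEquiv.finrank_eq, hfr]

lemma nonempty_blockChoice [Finite F] [NeZero n] (hn : (n : F) ≠ 0) (hodd : Odd n) (ε : FG F n)
    (hε : ε ∈ blockIds F n) : Nonempty (BlockChoice F n ε) := by
  obtain ⟨φ, hφ, hr⟩ := exists_matrix_hom hn hodd ⟨ε, hε⟩
  have : Finite (FG F n) := finite_monoidAlgebra
  have : Finite (BlockField ⟨ε, hε⟩) := Finite.of_injective _ BlockField.val_injective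
  have : CharP (BlockField ⟨ε, hε⟩) 2 := charP_of_injective_algebraMap (algebraMap F _).injective 2
  obtain ⟨E, hE, hE2⟩ := exists_quadratic_subfield (BlockField ⟨ε, hε⟩)
  exact ⟨{
    L := BlockField ⟨ε, hε⟩
    φ := φ
    injective_φ := hφ
    range_φ := hr
    E := E
    isField_E := hE
    finrank_E := hE2 }⟩

end BlockField

/-! ### Self-duality of the codes `α Ĉ β` -/

section SelfDual
variable {F : Type u} [Field F] {n : ℕ}

namespace BlockChoice
variable {ε : FG F n} (B : BlockChoice F n ε)

/-- The primitive idempotent corresponding to the first diagonal matrix unit. -/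
def p : FG F n := B.φ (Matrix.single 0 0 1)

variable {B}

lemma exists_φ_eq {x : FG F n} (hx : x * ε = x) : ∃ M, B.φ M = x := by
  have : x ∈ Set.range B.φ := by rw [B.range_φ]; exact ⟨x, hx.symm⟩
  exact this

lemma φ_mul_block (hε : ε ∈ blockIds F n) (M) : B.φ M * ε = B.φ M := by
  have : B.φ M ∈ Set.range B.φ := ⟨M, rfl⟩
  rw [B.range_φ] at this
  obtain ⟨a, ha⟩ := this
  rw [ha, mul_assoc, block_mul_self hε]

lemma φ_one (hε : ε ∈ blockIds F n) : B.φ 1 = ε := by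
  obtain ⟨M, hM⟩ := exists_φ_eq (B := B) (block_mul_self hε)
  have h := map_mul B.φ 1 M
  rw [one_mul, hM, φ_mul_block hε] at h
  exact h.symm

lemma p_mul_block (hε : ε ∈ blockIds F n) : B.p * ε = B.p := φ_mul_block hε _

lemma p_mul_p : B.p * B.p = B.p := by
  rw [p, ← map_mul, Matrix.single_mul_single_same, one_mul]

lemma exists_scalar {z : FG F n} (hz : ∀ x, Commute z x)
    (hzε : z * ε = z) : ∃ c : B.L, B.φ (Matrix.scalar (Fin 2) c) = z := by
  obtain ⟨M, hM⟩ := exists_φ_eq (B := B) hzε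
  have : M ∈ Set.range (Matrix.scalar (Fin 2)) := by
    rw [Matrix.mem_range_scalar_iff_commute_single']
    intro i j
    apply B.injective_φ
    rw [map_mul, map_mul, hM, (hz _).eq]
  obtain ⟨c, rfl⟩ := this
  exact ⟨c, hM⟩

lemma bar_mul_block (hε : ε ∈ blockIds F n) {x : FG F n} (hx : x * ε = x) :
    bar x * ε = bar x := by
  nth_rewrite 1 [← bar_block hε]
  rw [← bar_mul, (block_commute hε x).eq, hx]

/-- The norm and trace of `p` are central, hence scalar matrices. A product with left factor `E₀₀`
has zero second row, so the norm is 0; multiplying the trace by `p` then gives `p`, so the trace is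
1. -/
lemma p_add_bar_p [CharP F 2] (hε : ε ∈ blockIds F n) : B.p + bar B.p = ε := by
  obtain ⟨z, hzF, hzb, h1, h2⟩ := exists_mul_bar B.p
  obtain ⟨w, hwF, hwb, h3⟩ := exists_add_bar B.p
  have hp := p_mul_block (B := B) hε
  have hp' := bar_mul_block hε hp
  obtain ⟨c, hc⟩ := exists_scalar (B := B) (commute_of_bar_eq hzF hzb)
    (by rw [← h1, mul_assoc, hp'])
  obtain ⟨d, hd⟩ := exists_scalar (B := B) (commute_of_bar_eq hwF hwb)
    (by rw [← h3, add_mul, hp, hp'])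
  obtain ⟨M, hM⟩ := exists_φ_eq (B := B) hp'
  have hz : z = 0 := by
    have h : Matrix.single 0 0 1 * M = Matrix.scalar (Fin 2) c :=
      B.injective_φ (by rw [map_mul, hM, hc]; exact h1)
    have h11 := congrFun (congrFun h 1) 1
    have hc0 : c = 0 := by simpa [Matrix.mul_apply, Matrix.single_apply] using h11.symm
    rw [← hc, hc0, map_zero, map_zero]
  have hw : w * B.p = B.p := by rw [← h3, add_mul, p_mul_p, h2, hz, add_zero]
  have h : Matrix.scalar (Fin 2) d * Matrix.single 0 0 1 = Matrix.single 0 0 1 :=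
    B.injective_φ (by rw [map_mul, hd]; exact hw)
  have h00 := congrFun (congrFun h 0) 0
  have hd1 : d = 1 := by simpa using h00
  rw [h3, ← hd, hd1, map_one, φ_one hε]

lemma mem_C_iff (hε : ε ∈ blockIds F n) {x : FG F n} : x ∈ B.C ↔ x * B.p = x := by
  constructor
  · intro hx
    induction hx using Submodule.span_induction with
    | mem x h =>
      obtain ⟨a, rfl⟩ := h
      rw [p, ← map_mul, mul_assoc, Matrix.single_mul_single_same, one_mul]
    | zero => simp
    | add x y _ _ hx hy => rw [add_mul, hx, hy]
    | smul c x _ hx => rw [smul_mul_assoc, hx]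
  · intro hx
    apply Submodule.subset_span
    obtain ⟨M, hM⟩ := exists_φ_eq (B := B) (x := x) (by rw [← hx, mul_assoc, p_mul_block hε])
    exact ⟨M, by rw [map_mul, hM]; exact hx.symm⟩

lemma K_mul_block (hε : ε ∈ blockIds F n) {x : FG F n} (hx : x ∈ B.K) : x * ε = x := by
  obtain ⟨a, -, rfl⟩ := hx
  exact φ_mul_block hε a

lemma exists_inv_mem_K (hε : ε ∈ blockIds F n) {x : FG F n} (hx : x ∈ B.K) (h0 : x ≠ 0) :
    ∃ y ∈ B.K, y ≠ 0 ∧ x * y = ε ∧ y * x = ε := by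
  obtain ⟨a, ha, rfl⟩ := hx
  have ha0 : (⟨a, ha⟩ : B.E) ≠ 0 := by
    intro h
    apply h0
    rw [show a = 0 from congrArg Subtype.val h, map_zero]
  obtain ⟨b, hb⟩ := B.isField_E.mul_inv_cancel ha0
  have hba := (B.isField_E.mul_comm _ _).trans hb
  have h1 : B.φ a * B.φ b = ε := by
    rw [← map_mul]
    exact (congrArg B.φ (congrArg Subtype.val hb)).trans (φ_one hε)
  have h2 : B.φ b * B.φ a = ε := by
    rw [← map_mul]
    exact (congrArg B.φ (congrArg Subtype.val hba)).trans (φ_one hε)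
  refine ⟨B.φ b, ⟨b, b.2, rfl⟩, fun h => ?_, h1, h2⟩
  rw [h, mul_zero] at h1
  exact block_ne_zero hε h1.symm

end BlockChoice

lemma e0hat_eq [NeZero n] : e0hat F n = e0 F n * (1 + reflv F n) := by
  rw [e0hat, mul_add, mul_one, reflv_mul e0_mem_FH, bar_e0]

lemma e0_commute [NeZero n] (x : FG F n) : Commute (e0 F n) x :=
  commute_of_bar_eq e0_mem_FH bar_e0 x

lemma bar_e0hat [NeZero n] : bar (e0hat F n) = e0hat F n := by
  rw [e0hat_eq, bar_mul, bar_e0, bar_add, bar_one, bar_reflv, (e0_commute _).eq]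

lemma e0_mul_e0hat [NeZero n] (hn : (n : F) ≠ 0) : e0 F n * e0hat F n = e0hat F n := by
  rw [e0hat_eq, ← mul_assoc, e0_mul_e0 hn]

lemma e0hat_ne_zero [NeZero n] (hn : (n : F) ≠ 0) : e0hat F n ≠ 0 := by
  intro h
  rw [e0hat_eq, mul_add, mul_one] at h
  exact e0_ne_zero hn (eq_zero_of_add_mul_reflv e0_mem_FH e0_mem_FH h).1

lemma exists_mul_e0_eq [NeZero n] (x : FG F n) : ∃ c d : F,
    x * e0 F n = c • e0 F n + d • (e0 F n * reflv F n) := by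
  obtain ⟨a, ha, b, hb, rfl⟩ := exists_eq_add_mul_reflv x
  obtain ⟨c, hc⟩ := exists_mul_e0 ha
  obtain ⟨d, hd⟩ := exists_mul_e0 hb
  refine ⟨c, d, ?_⟩
  rw [add_mul, hc, mul_assoc, ← (e0_commute (reflv F n)).eq, ← mul_assoc, hd, smul_mul_assoc]

/-- The ideal `FG e₀` is spanned by `e₀` and `e₀ v`. In characteristic 2 the element `ê₀` squares to
zero, and its annihilator there is its own span. -/
lemma mul_e0hat_eq_zero_iff [NeZero n] [CharP F 2] (hn : (n : F) ≠ 0) {x : FG F n} :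
    x * e0hat F n = 0 ↔ ∃ c : F, x * e0 F n = c • e0hat F n := by
  have hv : reflv F n * e0hat F n = e0hat F n := by
    rw [e0hat, mul_add, ← mul_assoc, reflv_mul_reflv, one_mul, add_comm]
  constructor
  · intro h
    obtain ⟨c, d, hcd⟩ := exists_mul_e0_eq x
    rw [← e0_mul_e0hat hn, ← mul_assoc, hcd, add_mul, smul_mul_assoc, smul_mul_assoc, mul_assoc,
      hv, e0_mul_e0hat hn, ← add_smul] at h
    have hc : c + d = 0 := (smul_eq_zero.1 h).resolve_right (e0hat_ne_zero hn)
    have : c = d := by rw [← sub_eq_zero, CharTwo.sub_eq_add, hc]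
    exact ⟨c, by rw [hcd, ← this, e0hat_eq, mul_add, mul_one, smul_add]⟩
  · rintro ⟨c, hc⟩
    rw [← e0_mul_e0hat hn, ← mul_assoc, hc, smul_mul_assoc]
    have : e0hat F n * e0hat F n = 0 := by
      nth_rewrite 1 [e0hat_eq]
      rw [mul_assoc, add_mul, one_mul, hv, FG_add_self, mul_zero]
    rw [this, smul_zero]

variable [NeZero n] [CharP F 2]

omit [NeZero n] [CharP F 2] in
lemma mul_eq_zero_of_mem_Chat {B : ∀ ε : blockIds F n, BlockChoice F n (ε : FG F n)} {a : FG F n}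
    (h0 : e0hat F n * a = 0) (h : ∀ ε, (B ε).p * a = 0) {x : FG F n} (hx : x ∈ Chat B) :
    x * a = 0 := by
  have hle : Chat B ≤ (LinearMap.mulRight F a).ker := by
    rw [Chat, sup_le_iff, Submodule.span_singleton_le_iff_mem, iSup_le_iff]
    refine ⟨h0, fun ε y hy => ?_⟩
    rw [(B ε).mem_C_iff ε.2] at hy
    rw [LinearMap.mem_ker, LinearMap.mulRight_apply, ← hy, mul_assoc, h, mul_zero]
  exact hle hx

/-- Since `bar p = ε - p`, the equation `x * bar p = 0` says that `x ε = x p`, that is, the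
component of `x` in this block lies in `C_t`. The condition on `ê₀` treats the remaining component
in the same way. -/
lemma mem_Chat_iff [Finite F] (hn : (n : F) ≠ 0)
    (B : ∀ ε : blockIds F n, BlockChoice F n (ε : FG F n)) {x : FG F n} :
    x ∈ Chat B ↔ x * e0hat F n = 0 ∧ ∀ ε, x * bar (B ε).p = 0 := by
  have : Finite (FG F n) := finite_monoidAlgebra
  have : Fintype (blockIds F n) := Fintype.ofFinite _
  have hpp : ∀ ε, (B ε).p * bar (B ε).p = 0 := by
    intro ε
    have : bar (B ε).p = (ε : FG F n) + (B ε).p := by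
      have h := congrArg ((B ε).p + ·) ((B ε).p_add_bar_p ε.2)
      simp only [← add_assoc, FG_add_self, zero_add] at h
      rw [h, add_comm]
    rw [this, mul_add, (B ε).p_mul_block ε.2, (B ε).p_mul_p, FG_add_self]
  have hp0 : ∀ ε, (B ε).p * e0hat F n = 0 := by
    intro ε
    rw [← (B ε).p_mul_block ε.2, e0hat_eq, mul_assoc, ← mul_assoc (ε : FG F n),
      FH_mul_comm (block_mem_FH ε.2) e0_mem_FH, e0_mul_block hn ε.2, zero_mul, mul_zero]
  have hne : ∀ ε ε', ε ≠ ε' → (B ε).p * bar (B ε').p = 0 := by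
    intro ε ε' h
    rw [← (B ε).p_mul_block ε.2, ← BlockChoice.bar_mul_block ε'.2 ((B ε').p_mul_block ε'.2),
      ← (block_commute ε'.2 _).eq, mul_assoc, ← mul_assoc (ε : FG F n),
      block_mul_block ε.2 ε'.2 fun h' => h (Subtype.ext h'), zero_mul, mul_zero]
  constructor
  · intro hx
    refine ⟨mul_eq_zero_of_mem_Chat ?_ hp0 hx, fun ε => mul_eq_zero_of_mem_Chat ?_ ?_ hx⟩
    · rw [mul_e0hat_eq_zero_iff hn]
      exact ⟨1, by rw [← (e0_commute _).eq, e0_mul_e0hat hn, one_smul]⟩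
    · have := congrArg bar (hp0 ε)
      rwa [bar_mul, bar_e0hat, bar_zero] at this
    · intro ε'
      by_cases h : ε' = ε
      · subst h; exact hpp _
      · exact hne _ _ h
  · rintro ⟨h0, h⟩
    obtain ⟨c, hc⟩ := (mul_e0hat_eq_zero_iff hn).1 h0
    have hx : x = x * e0 F n + ∑ ε : blockIds F n, x * (ε : FG F n) := by
      rw [← Finset.mul_sum, ← mul_add, block_sum hn, mul_one]
    rw [hx, Chat]
    apply Submodule.add_mem_sup
    · rw [hc]
      exact Submodule.smul_mem _ _ (Submodule.mem_span_singleton_self _)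
    · refine Submodule.sum_mem _ fun ε _ => Submodule.mem_iSup_of_mem ε ?_
      rw [(B ε).mem_C_iff ε.2]
      have h1 := congrArg (x * ·) ((B ε).p_add_bar_p ε.2)
      simp only [mul_add, h, add_zero] at h1
      rw [mul_assoc, (block_commute ε.2 _).eq, (B ε).p_mul_block ε.2, h1]

lemma mul_mem_Chat [Finite F] (hn : (n : F) ≠ 0)
    (B : ∀ ε : blockIds F n, BlockChoice F n (ε : FG F n)) (a : FG F n) {x : FG F n}
    (hx : x ∈ Chat B) : a * x ∈ Chat B := by
  rw [mem_Chat_iff hn] at hx ⊢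
  exact ⟨by rw [mul_assoc, hx.1, mul_zero], fun ε => by rw [mul_assoc, hx.2, mul_zero]⟩

omit [CharP F 2] in
lemma add_finsum_mul_block [Finite F] (hn : (n : F) ≠ 0) {κ : blockIds F n → FG F n}
    (hκ : ∀ ε, κ ε * (ε : FG F n) = κ ε) (ε : blockIds F n) :
    (e0 F n + ∑ᶠ ε, κ ε) * (ε : FG F n) = κ ε := by
  have : Finite (FG F n) := finite_monoidAlgebra
  have : Fintype (blockIds F n) := Fintype.ofFinite _
  rw [finsum_eq_sum_of_fintype, add_mul, e0_mul_block hn ε.2, zero_add, Finset.sum_mul,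
    Finset.sum_eq_single ε, hκ]
  · intro b _ hb
    rw [← hκ b, mul_assoc, block_mul_block b.2 ε.2 fun h => hb (Subtype.ext h), mul_zero]
  · simp

omit [CharP F 2] in
lemma add_finsum_mul_e0 [Finite F] (hn : (n : F) ≠ 0) {κ : blockIds F n → FG F n}
    (hκ : ∀ ε, κ ε * (ε : FG F n) = κ ε) : (e0 F n + ∑ᶠ ε, κ ε) * e0 F n = e0 F n := by
  have : Finite (FG F n) := finite_monoidAlgebra
  have : Fintype (blockIds F n) := Fintype.ofFinite _
  rw [finsum_eq_sum_of_fintype, add_mul, e0_mul_e0 hn, Finset.sum_mul,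
    Finset.sum_eq_zero, add_zero]
  intro b _
  rw [← hκ b, mul_assoc, FH_mul_comm (block_mem_FH b.2) e0_mem_FH, e0_mul_block hn b.2, mul_zero]

omit [CharP F 2] in
lemma exists_inv_mem_Kstar [Finite F] (hn : (n : F) ≠ 0)
    {B : ∀ ε : blockIds F n, BlockChoice F n (ε : FG F n)} {α : FG F n} (hα : α ∈ Kstar B) :
    ∃ α' ∈ Kstar B, α * α' = 1 ∧ α' * α = 1 := by
  have : Finite (FG F n) := finite_monoidAlgebra
  have : Fintype (blockIds F n) := Fintype.ofFinite _
  obtain ⟨κ, hκ, rfl⟩ := hα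
  choose κ' hκ' h0 h1 h2 using fun ε => (B ε).exists_inv_mem_K ε.2 (hκ ε).1 (hκ ε).2
  have hε := fun ε => (B ε).K_mul_block ε.2 (hκ ε).1
  have hε' := fun ε => (B ε).K_mul_block ε.2 (hκ' ε)
  have key : ∀ a b : FG F n, a * e0 F n = e0 F n → b * e0 F n = e0 F n →
      (∀ ε : blockIds F n, (a * ε) * (b * ε) = ε) → a * b = 1 := by
    intro a b ha hb hab
    rw [← block_sum (F := F) hn, ← mul_one (a * b), ← block_sum (F := F) hn, mul_add, mul_assoc, hb, ha,
      Finset.mul_sum]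
    congr 1
    refine Finset.sum_congr rfl fun ε _ => ?_
    nth_rewrite 2 [← hab ε]
    rw [mul_assoc a (ε : FG F n), ← mul_assoc (ε : FG F n), (block_commute ε.2 b).eq, mul_assoc b,
      block_mul_self ε.2, mul_assoc]
  refine ⟨e0 F n + ∑ᶠ ε, κ' ε, ⟨κ', fun ε => ⟨hκ' ε, h0 ε⟩, rfl⟩, ?_, ?_⟩
  · apply key _ _ (add_finsum_mul_e0 hn hε) (add_finsum_mul_e0 hn hε')
    intro ε
    rw [add_finsum_mul_block hn hε, add_finsum_mul_block hn hε', h1]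
  · apply key _ _ (add_finsum_mul_e0 hn hε') (add_finsum_mul_e0 hn hε)
    intro ε
    rw [add_finsum_mul_block hn hε, add_finsum_mul_block hn hε', h2]

omit [CharP F 2] in
lemma Kstar_mul_e0 [Finite F] (hn : (n : F) ≠ 0)
    {B : ∀ ε : blockIds F n, BlockChoice F n (ε : FG F n)} {α : FG F n} (hα : α ∈ Kstar B) :
    α * e0 F n = e0 F n := by
  obtain ⟨κ, hκ, rfl⟩ := hα
  exact add_finsum_mul_e0 hn fun ε => (B ε).K_mul_block ε.2 (hκ ε).1

/-- As `Ĉ` is a left ideal and `α` is invertible, `α Ĉ β = Ĉ β`: membership does not involve `α`. -/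
lemma mem_randomCode_iff [Finite F] (hn : (n : F) ≠ 0)
    {B : ∀ ε : blockIds F n, BlockChoice F n (ε : FG F n)} {α β β' : FG F n} (hα : α ∈ Kstar B)
    (hβ : β * β' = 1) (hβ' : β' * β = 1) {x : FG F n} :
    x ∈ randomCode B α β ↔ x * β' ∈ Chat B := by
  obtain ⟨α', -, h1, -⟩ := exists_inv_mem_Kstar hn hα
  constructor
  · rintro ⟨c, hc, rfl⟩
    rw [mul_assoc, hβ, mul_one]
    exact mul_mem_Chat hn B _ hc
  · intro h
    refine ⟨α' * (x * β'), mul_mem_Chat hn B _ h, ?_⟩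
    rw [← mul_assoc, h1, one_mul, mul_assoc, hβ', mul_one]

lemma isGroupCode_randomCode [Finite F] (hn : (n : F) ≠ 0)
    {B : ∀ ε : blockIds F n, BlockChoice F n (ε : FG F n)} {α β : FG F n} (hα : α ∈ Kstar B)
    (hβ : β ∈ Kstar B) : IsGroupCode (randomCode B α β) := by
  obtain ⟨β', -, h1, h2⟩ := exists_inv_mem_Kstar hn hβ
  refine ⟨{ carrier := randomCode B α β, add_mem' := ?_, zero_mem' := ?_, smul_mem' := ?_ }, rfl⟩
  · intro x y hx hy
    rw [mem_randomCode_iff hn hα h1 h2] at hx hy ⊢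
    rw [add_mul]
    exact add_mem hx hy
  · rw [mem_randomCode_iff hn hα h1 h2, zero_mul]
    exact zero_mem _
  · intro a x hx
    rw [mem_randomCode_iff hn hα h1 h2] at hx ⊢
    rw [smul_eq_mul, mul_assoc]
    exact mul_mem_Chat hn B a hx

/-- The norm `N = β * bar β` is a central unit, so `bar β = N β⁻¹`. Hence the products `y β * bar x`
that express orthogonality to `Ĉ β` vanish exactly when `x β⁻¹ * bar y` does, and for `y` among the
generators `ê₀`, `p` of `Ĉ` this is membership of `x β⁻¹` in `Ĉ`. -/
lemma isSelfDual_randomCode [Finite F] (hn : (n : F) ≠ 0)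
    {B : ∀ ε : blockIds F n, BlockChoice F n (ε : FG F n)} {α β : FG F n} (hα : α ∈ Kstar B)
    (hβ : β ∈ Kstar B) : IsSelfDual (randomCode B α β) := by
  obtain ⟨I, hI⟩ := isGroupCode_randomCode hn hα hβ
  obtain ⟨β', hβ', h1, h2⟩ := exists_inv_mem_Kstar hn hβ
  have hmem : ∀ x, x ∈ I ↔ x * β' ∈ Chat B := fun x => by
    rw [← mem_randomCode_iff hn hα h1 h2, ← hI]; rfl
  have hmem' : ∀ y ∈ Chat B, y * β ∈ I := fun y hy => by
    rw [hmem, mul_assoc, h1, mul_one]; exact hy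
  obtain ⟨N, hNF, hNb, hN, -⟩ := exists_mul_bar β
  have hNc := commute_of_bar_eq hNF hNb
  have hbβ : bar β = N * β' := by rw [(hNc β').eq, ← hN, ← mul_assoc, h2, one_mul]
  have hNu : bar β' * β' * N = 1 := by
    rw [← hN, mul_assoc, ← mul_assoc β', h2, one_mul, ← bar_mul, h1, bar_one]
  have hN0 : ∀ y, N * y = 0 → y = 0 := fun y hy => by
    rw [← one_mul y, ← hNu, mul_assoc, hy, mul_zero]
  have hbar : ∀ x y, bar (y * β * bar x) = N * (x * β' * bar y) := fun x y => by
    rw [bar_mul, bar_mul, bar_bar, hbβ, mul_assoc N, ← mul_assoc, ← (hNc x).eq, mul_assoc,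
      ← mul_assoc x]
  have hmem0 : e0hat F n ∈ Chat B :=
    Submodule.mem_sup_left (Submodule.mem_span_singleton_self _)
  have hmemp : ∀ ε, (B ε).p ∈ Chat B := fun ε =>
    Submodule.mem_sup_right (Submodule.mem_iSup_of_mem ε (((B ε).mem_C_iff ε.2).2 (B ε).p_mul_p))
  ext x
  rw [← hI, mem_orthogonalCode_iff]
  change x ∈ I ↔ _
  rw [hmem, mem_Chat_iff hn]
  constructor
  · rintro ⟨hx0, hx⟩ c hc
    have hc' : c * bar x = c * β' * (β * bar x) := by
      rw [mul_assoc, ← mul_assoc β', h2, one_mul]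
    rw [hc']
    refine mul_eq_zero_of_mem_Chat (B := B) ?_ (fun ε => ?_) ((hmem c).1 hc)
    · apply bar_injective
      rw [← mul_assoc, hbar, bar_e0hat, hx0, mul_zero, bar_zero]
    · apply bar_injective
      rw [← mul_assoc, hbar, hx, mul_zero, bar_zero]
  · intro h
    have key : ∀ y ∈ Chat B, x * β' * bar y = 0 := fun y hy => by
      apply hN0
      rw [← hbar, h _ (hmem' y hy), bar_zero]
    refine ⟨?_, fun ε => key _ (hmemp ε)⟩
    rw [← bar_e0hat]
    exact key _ hmem0

end SelfDual

/-! ### Counting: the parameters `β` for a given word, and the sizes of ideals and blocks -/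

lemma ncard_univ_pi {ι : Type*} [Fintype ι] {α : ι → Type*} (s : ∀ i, Set (α i)) :
    (Set.univ.pi s).ncard = ∏ i, (s i).ncard := by
  simp only [← Nat.card_coe_set_eq]
  rw [Nat.card_congr (Equiv.Set.univPi s), Nat.card_pi]

section Counting
variable {F : Type u} [Field F] [Finite F] {n : ℕ}

namespace BlockChoice
section Block
variable {ε : FG F n} (B : BlockChoice F n ε)

/-- The cardinality of the centre of a block. -/
def Q : ℕ := Nat.card B.L

variable {B}

lemma finite_L [NeZero n] : Finite B.L := by
  have : Finite (FG F n) := finite_monoidAlgebra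
  have : Finite (Matrix (Fin 2) (Fin 2) B.L) := Finite.of_injective _ B.injective_φ
  exact Finite.of_injective (fun c : B.L => Matrix.diagonal fun _ : Fin 2 => c) fun c d h => by
    simpa using congrFun (congrFun h 0) 0

lemma one_lt_Q [NeZero n] : 1 < B.Q := by
  have := B.finite_L
  exact Finite.one_lt_card

lemma K_ncard [NeZero n] : B.K.ncard = B.Q ^ 2 := by
  have : B.K = B.φ '' (B.E : Set (Matrix (Fin 2) (Fin 2) B.L)) := by
    ext x; exact ⟨fun ⟨a, h, h'⟩ => ⟨a, h, h'.symm⟩, fun ⟨a, h, h'⟩ => ⟨a, h, h'.symm⟩⟩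
  rw [this, Set.ncard_image_of_injective _ B.injective_φ, ← Nat.card_coe_set_eq]
  have hf := B.finite_L
  have h := Module.natCard_eq_pow_finrank (K := B.L) (V := B.E)
  rw [B.finrank_E] at h
  exact h

lemma K_diff_ncard [NeZero n] : {κ | κ ∈ B.K ∧ κ ≠ 0}.ncard = (B.Q - 1) * (B.Q + 1) := by
  have : Finite (FG F n) := finite_monoidAlgebra
  have h0 : (0 : FG F n) ∈ B.K := ⟨0, zero_mem _, (map_zero _).symm⟩
  have h : {κ | κ ∈ B.K ∧ κ ≠ 0} = B.K \ {0} := rfl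
  rw [h, Set.ncard_sdiff_singleton_of_mem h0, K_ncard, mul_comm, ← Nat.sq_sub_sq, one_pow]

lemma ncard_block [NeZero n] (hε : ε ∈ blockIds F n) : {x : FG F n | x * ε = x}.ncard = B.Q ^ 4 := by
  have : {x : FG F n | x * ε = x} = B.φ '' Set.univ := by
    ext x
    constructor
    · intro h
      obtain ⟨M, hM⟩ := exists_φ_eq (B := B) h
      exact ⟨M, trivial, hM⟩
    · rintro ⟨M, -, rfl⟩
      exact φ_mul_block hε M
  have hf := B.finite_L
  rw [this, Set.ncard_image_of_injective _ B.injective_φ, Set.ncard_univ]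
  change Nat.card (Fin 2 → Fin 2 → B.L) = _
  rw [Nat.card_fun, Nat.card_fun, Nat.card_fin, ← pow_mul]; rfl

omit [Finite F] in
-- A nonzero difference would be an invertible matrix with a zero row.
lemma eq_of_row_eq {a b : Matrix (Fin 2) (Fin 2) B.L} (ha : a ∈ B.E) (hb : b ∈ B.E)
    (h : ∀ j, a 0 j = b 0 j) : a = b := by
  by_contra hne
  have h0 : (⟨a, ha⟩ - ⟨b, hb⟩ : B.E) ≠ 0 := fun h =>
    hne (sub_eq_zero.1 (congrArg Subtype.val h))
  obtain ⟨c, hc⟩ := B.isField_E.mul_inv_cancel h0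
  have h1 : (a - b) * (c : Matrix (Fin 2) (Fin 2) B.L) = 1 := congrArg Subtype.val hc
  have h2 := congrFun (congrFun h1 0) 0
  rw [Matrix.mul_apply, Fin.sum_univ_two] at h2
  simp [h] at h2

/-- A nonzero element of the block lies in `C κ` for few `κ ∈ K`. -/
lemma ncard_mul_Q_le [NeZero n] {y : FG F n} (hy : y * ε = y)
    (hy0 : y ≠ 0) : {κ | (κ ∈ B.K ∧ κ ≠ 0) ∧ ∃ c ∈ B.C, y = c * κ}.ncard * B.Q ≤
      {κ | κ ∈ B.K ∧ κ ≠ 0}.ncard := by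
  have hfin := B.finite_L
  have hfG : Finite (FG F n) := finite_monoidAlgebra
  obtain ⟨Y, rfl⟩ := exists_φ_eq (B := B) hy
  have hY : ∃ i j, Y i j ≠ 0 := by
    by_contra! h
    exact hy0 (by rw [show Y = 0 from Matrix.ext h, map_zero])
  obtain ⟨i, j, hij⟩ := hY
  -- Elements of `C` have zero second column, so every row of `c * κ` is a multiple of the first row
  -- of `κ`.
  have hrow : ∀ k, (∃ c ∈ B.C, B.φ Y = c * B.φ k) → ∃ m, ∀ j, Y i j = m * k 0 j := by
    rintro k ⟨c, hc, h⟩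
    have hc' : ∃ M, B.φ (M * Matrix.single 0 0 1) = c := by
      clear h
      induction hc using Submodule.span_induction with
      | mem x h => obtain ⟨a, rfl⟩ := h; exact ⟨a, rfl⟩
      | zero => exact ⟨0, by rw [zero_mul, map_zero]⟩
      | add x y _ _ hx hy =>
        obtain ⟨a, rfl⟩ := hx
        obtain ⟨b, rfl⟩ := hy
        exact ⟨a + b, by rw [add_mul, map_add]⟩
      | smul r x _ hx =>
        obtain ⟨a, rfl⟩ := hx
        exact ⟨r • a, by rw [smul_mul_assoc, map_smul]⟩
    obtain ⟨M, rfl⟩ := hc'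
    rw [← map_mul] at h
    refine ⟨M i 0, fun j => ?_⟩
    rw [B.injective_φ h, Matrix.mul_apply, Fin.sum_univ_two]
    simp [Matrix.mul_apply, Matrix.single_apply]
  -- Row `i` of `Y` is nonzero, so the first row of `κ` is prescribed up to a scalar and is
  -- determined by its nonzero entry at `j`. By `eq_of_row_eq` so is `κ`, which leaves at most `Q -
  -- 1` candidates.
  have hle : {κ | (κ ∈ B.K ∧ κ ≠ 0) ∧ ∃ c ∈ B.C, B.φ Y = c * κ}.ncard ≤ B.Q - 1 := by
    have h1 : ({l : B.L | l ≠ 0}).ncard = B.Q - 1 := by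
      have : {l : B.L | l ≠ 0} = Set.univ \ {0} := by ext; simp
      rw [this, Set.ncard_sdiff_singleton_of_mem (Set.mem_univ _), Set.ncard_univ, Q]
    rw [← h1]
    refine Set.ncard_le_ncard_of_injOn (fun κ => Function.invFun B.φ κ 0 j) ?_ ?_ (Set.toFinite _)
    · rintro _ ⟨⟨⟨k, hk, rfl⟩, -⟩, hc⟩
      obtain ⟨m, hm⟩ := hrow k hc
      rw [Function.leftInverse_invFun B.injective_φ k]
      intro h
      rw [hm j, h, mul_zero] at hij
      exact hij rfl
    · rintro _ ⟨⟨⟨k, hk, rfl⟩, -⟩, hc⟩ _ ⟨⟨⟨k', hk', rfl⟩, -⟩, hc'⟩ he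
      obtain ⟨m, hm⟩ := hrow k hc
      obtain ⟨m', hm'⟩ := hrow k' hc'
      simp only [Function.leftInverse_invFun B.injective_φ _] at he
      have hkj : k 0 j ≠ 0 := fun h => hij (by rw [hm, h, mul_zero])
      have hmm : m = m' := by
        apply mul_right_cancel₀ hkj
        rw [← hm, he, ← hm']
      have hm0 : m ≠ 0 := fun h => hij (by rw [hm, h, zero_mul])
      rw [eq_of_row_eq hk hk' fun j => ?_]
      apply mul_left_cancel₀ hm0
      rw [← hm, hm', hmm]
  rw [K_diff_ncard]
  exact Nat.mul_le_mul hle (Nat.le_succ _)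

end Block
end BlockChoice

variable [NeZero n] [Fintype (blockIds F n)]

omit [Finite F] [NeZero n] [Fintype (blockIds F n)] in
lemma Kstar_eq_image (B : ∀ ε : blockIds F n, BlockChoice F n (ε : FG F n)) :
    Kstar B = (fun κ => e0 F n + ∑ᶠ ε, κ ε) '' Set.univ.pi fun ε => {κ | κ ∈ (B ε).K ∧ κ ≠ 0} := by
  ext x
  constructor
  · rintro ⟨κ, hκ, rfl⟩
    exact ⟨κ, fun ε _ => hκ ε, rfl⟩
  · rintro ⟨κ, hκ, rfl⟩
    exact ⟨κ, fun ε => hκ ε trivial, rfl⟩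

omit [Fintype (blockIds F n)] in
lemma injOn_add_finsum (hn : (n : F) ≠ 0) {s : Set (blockIds F n → FG F n)}
    (hs : ∀ κ ∈ s, ∀ ε, κ ε * (ε : FG F n) = κ ε) :
    Set.InjOn (fun κ => e0 F n + ∑ᶠ ε, κ ε) s := by
  intro κ hκ κ' hκ' h
  funext ε
  rw [← add_finsum_mul_block hn (hs κ hκ) ε, ← add_finsum_mul_block hn (hs κ' hκ') ε]
  exact congrArg (· * (ε : FG F n)) h

lemma ncard_Kstar (hn : (n : F) ≠ 0) (B : ∀ ε : blockIds F n, BlockChoice F n (ε : FG F n)) :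
    (Kstar B).ncard = ∏ ε, {κ | κ ∈ (B ε).K ∧ κ ≠ 0}.ncard := by
  rw [Kstar_eq_image, Set.InjOn.ncard_image, ncard_univ_pi]
  exact injOn_add_finsum hn fun κ hκ ε => (B ε).K_mul_block ε.2 (hκ ε trivial).1

lemma ncard_Kstar_pos (hn : (n : F) ≠ 0) (B : ∀ ε : blockIds F n, BlockChoice F n (ε : FG F n)) :
    0 < (Kstar B).ncard := by
  rw [ncard_Kstar hn]
  refine Finset.prod_pos fun ε _ => ?_
  rw [BlockChoice.K_diff_ncard]
  exact Nat.mul_pos (Nat.sub_pos_of_lt (B ε).one_lt_Q) (Nat.succ_pos _)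

omit [Fintype (blockIds F n)] in
lemma mul_block_mem_C [CharP F 2] (hn : (n : F) ≠ 0)
    {B : ∀ ε : blockIds F n, BlockChoice F n (ε : FG F n)} {x : FG F n} (hx : x ∈ Chat B)
    (ε : blockIds F n) : x * (ε : FG F n) ∈ (B ε).C := by
  rw [(B ε).mem_C_iff ε.2]
  have h1 := congrArg (x * ·) ((B ε).p_add_bar_p ε.2)
  simp only [mul_add, ((mem_Chat_iff hn B).1 hx).2, add_zero] at h1
  rw [mul_assoc, (block_commute ε.2 _).eq, (B ε).p_mul_block ε.2, h1]

open Classical in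
/-- The blocks on which an element of `FG` has a nonzero component. -/
def blockSupport (y : FG F n) : Finset (blockIds F n) :=
  Finset.univ.filter fun ε => y * (ε : FG F n) ≠ 0

open Classical in
/-- A word is contained in `α Ĉ β` for few `β`. -/
lemma ncard_mul_prod_le [CharP F 2] (hn : (n : F) ≠ 0)
    (B : ∀ ε : blockIds F n, BlockChoice F n (ε : FG F n)) (α y : FG F n) :
    {β | β ∈ Kstar B ∧ y ∈ randomCode B α β}.ncard *
      ∏ ε ∈ blockSupport y, (B ε).Q ≤ (Kstar B).ncard := by
  have hfG : Finite (FG F n) := finite_monoidAlgebra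
  -- Membership of `y` imposes an independent condition on the component of `β` in each block of the
  -- support; the other components are left free.
  set S : ∀ ε : blockIds F n, Set (FG F n) := fun ε =>
    {κ | (κ ∈ (B ε).K ∧ κ ≠ 0) ∧ (y * (ε : FG F n) ≠ 0 → ∃ c ∈ (B ε).C, y * (ε : FG F n) = c * κ)} with hS
  have hsub : {β | β ∈ Kstar B ∧ y ∈ randomCode B α β} ⊆
      (fun κ => e0 F n + ∑ᶠ ε, κ ε) '' Set.univ.pi S := by
    rintro β ⟨⟨κ, hκ, rfl⟩, c, hc, hy⟩
    refine ⟨κ, fun ε _ => ⟨hκ ε, fun _ => ?_⟩, rfl⟩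
    refine ⟨_, mul_block_mem_C hn (mul_mem_Chat hn B α hc) ε, ?_⟩
    have h := add_finsum_mul_block hn (fun ε => (B ε).K_mul_block ε.2 (hκ ε).1) ε
    rw [hy, mul_assoc, h, mul_assoc (α * c), (block_commute ε.2 _).eq, (B ε).K_mul_block ε.2 (hκ ε).1]
  have h1 : {β | β ∈ Kstar B ∧ y ∈ randomCode B α β}.ncard ≤ ∏ ε, (S ε).ncard := by
    rw [← ncard_univ_pi]
    exact (Set.ncard_le_ncard hsub).trans (Set.ncard_image_le (Set.toFinite _))
  rw [ncard_Kstar hn, blockSupport, Finset.prod_filter]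
  refine (Nat.mul_le_mul_right _ h1).trans ?_
  rw [← Finset.prod_mul_distrib]
  refine Finset.prod_le_prod' fun ε _ => ?_
  split_ifs with h
  · have := (B ε).ncard_mul_Q_le (y := y * (ε : FG F n)) (by rw [mul_assoc, block_mul_self ε.2]) h
    simpa [hS, h] using this
  · rw [mul_one]
    exact Set.ncard_le_ncard fun κ hκ => hκ.1

/-- The elements of `FG` whose block components outside `T` vanish. -/
def blockIdeal (T : Finset (blockIds F n)) : Ideal (FG F n) where
  carrier := {x | ∀ ε ∉ T, x * (ε : FG F n) = 0}
  add_mem' hx hy ε hε := by rw [add_mul, hx ε hε, hy ε hε, add_zero]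
  zero_mem' ε _ := zero_mul _
  smul_mem' a x hx ε hε := by rw [smul_eq_mul, mul_assoc, hx ε hε, mul_zero]

open Classical in
-- By `block_sum` an element is determined by its components. The one in `FG e₀` has at most `q²`
-- values, whatever `T` is.
lemma card_blockIdeal_le (hn : (n : F) ≠ 0)
    (B : ∀ ε : blockIds F n, BlockChoice F n (ε : FG F n)) (T : Finset (blockIds F n)) :
    Nat.card (blockIdeal T) ≤ Nat.card F ^ 2 * ∏ ε ∈ T, (B ε).Q ^ 4 := by
  have hfG : Finite (FG F n) := finite_monoidAlgebra
  let A0 : Set (FG F n) :=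
    (fun c : F × F => c.1 • e0 F n + c.2 • (e0 F n * reflv F n)) '' Set.univ
  let S : Set (blockIds F n → FG F n) :=
    Set.univ.pi fun ε : blockIds F n => if ε ∈ T then {x | x * (ε : FG F n) = x} else {0}
  have h0 : A0.ncard ≤ Nat.card F ^ 2 := by
    refine (Set.ncard_image_le (Set.toFinite _)).trans ?_
    rw [Set.ncard_univ, Nat.card_prod, pow_two]
  have hS : S.ncard = ∏ ε ∈ T, (B ε).Q ^ 4 := by
    rw [ncard_univ_pi, ← Finset.prod_subset (Finset.subset_univ T)]
    · refine Finset.prod_congr rfl fun ε hε => ?_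
      rw [if_pos hε, (B ε).ncard_block ε.2]
    · intro ε _ hε
      rw [if_neg hε, Set.ncard_singleton]
  have h1 : Nat.card (blockIdeal T) ≤ (A0 ×ˢ S).ncard := by
    change Nat.card ((blockIdeal T : Set (FG F n))) ≤ _
    rw [Nat.card_coe_set_eq]
    refine Set.ncard_le_ncard_of_injOn
      (fun x => (x * e0 F n, fun ε : blockIds F n => x * (ε : FG F n))) ?_ ?_ (Set.toFinite _)
    · intro x hx
      refine ⟨?_, fun ε _ => ?_⟩
      · obtain ⟨c, d, h⟩ := exists_mul_e0_eq x
        exact ⟨(c, d), trivial, h.symm⟩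
      · change x * (ε : FG F n) ∈ (if ε ∈ T then {x | x * (ε : FG F n) = x} else {0} : Set (FG F n))
        split_ifs with h
        · change x * (ε : FG F n) * (ε : FG F n) = x * (ε : FG F n)
          rw [mul_assoc, block_mul_self ε.2]
        · exact hx ε h
    · intro x _ y _ h
      rw [Prod.mk.injEq] at h
      rw [← mul_one x, ← mul_one y, ← block_sum (F := F) hn, mul_add, mul_add, h.1, Finset.mul_sum, Finset.mul_sum]
      congr 1
      exact Finset.sum_congr rfl fun ε _ => congrFun h.2 ε
  rw [Set.ncard_prod, hS] at h1
  exact h1.trans (Nat.mul_le_mul_right _ h0)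

omit [Finite F] in
-- Nonzero orthogonal idempotents are linearly independent.
lemma card_blockIds_le : Fintype.card (blockIds F n) ≤ 2 * n := by
  have hli : LinearIndependent F (fun ε : blockIds F n => (ε : FG F n)) := by
    rw [Fintype.linearIndependent_iff]
    intro g hg ε
    have h := congrArg (· * (ε : FG F n)) hg
    simp only [Finset.sum_mul, zero_mul] at h
    rw [Finset.sum_eq_single ε] at h
    · rw [smul_mul_assoc, block_mul_self ε.2] at h
      exact (smul_eq_zero.1 h).resolve_right (block_ne_zero ε.2)
    · intro b _ hb
      rw [smul_mul_assoc, block_mul_block b.2 ε.2 fun h => hb (Subtype.ext h), smul_zero]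
    · simp
  let b : Module.Basis (DihedralGroup n) F (FG F n) :=
    ⟨MonoidAlgebra.coeffLinearEquiv ..⟩
  have hb := Module.finrank_eq_card_basis b
  have : Module.Finite F (FG F n) := Module.Finite.of_basis b
  rw [DihedralGroup.card] at hb
  rw [← hb]
  exact hli.fintype_card_le_finrank

omit [Fintype (blockIds F n)] [Finite F] in
/-- The centre of a block is large if `q` has large order modulo the prime `n`. -/
lemma pow_orderOf_le_Q_sq [Fintype F] (hp : n.Prime) (hn : (n : F) ≠ 0) {ε : FG F n}
    (hε : ε ∈ blockIds F n) (B : BlockChoice F n ε) :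
    Fintype.card F ^ orderOf (Fintype.card F : ZMod n) ≤ B.Q ^ 2 := by
  have hfin := B.finite_L
  have := Fintype.ofFinite B.L
  have := Fact.mk hp
  -- The matrix `M` of `u ε` has order exactly `n`, so the prime `n` divides `|GL₂| = (Q² - 1)(Q² -
  -- Q)`. As `n` does not divide `Q`, it divides `Q² - 1`. With `Q = q^k` the order of `q` modulo
  -- `n` divides `2k`.
  obtain ⟨M, hM⟩ := B.exists_φ_eq (x := rot F n * ε) (by rw [mul_assoc, block_mul_self hε])
  have hpow : ∀ k : ℕ, B.φ (M ^ (k + 1)) = rot F n ^ (k + 1) * ε := by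
    intro k
    induction k with
    | zero => simpa using hM
    | succ k ih =>
      rw [pow_succ, map_mul, ih, hM, mul_assoc, ← mul_assoc ε, (block_commute hε _).eq, mul_assoc (rot F n) ε, block_mul_self hε,
        ← mul_assoc, ← pow_succ]
  have hMn : M ^ n = 1 := by
    obtain ⟨m, rfl⟩ := Nat.exists_eq_succ_of_ne_zero hp.ne_zero
    apply B.injective_φ
    rw [hpow, rot_pow_card, one_mul, B.φ_one hε]
  have hM1 : M ≠ 1 := by
    rintro rfl
    rw [B.φ_one hε] at hM
    exact rot_mul_block_ne hn hε hM.symm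
  have hord : orderOf M = n := orderOf_eq_prime hMn hM1
  have hu : IsUnit M := IsUnit.of_pow_eq_one hMn hp.ne_zero
  obtain ⟨U, rfl⟩ := hu
  rw [orderOf_units] at hord
  have hdvd := orderOf_dvd_natCard U
  have hc := Matrix.card_GL_field (𝔽 := B.L) (n := 2)
  change Nat.card (Matrix (Fin 2) (Fin 2) B.L)ˣ = _ at hc
  rw [hc, hord, Fin.prod_univ_two] at hdvd
  have hQ : Fintype.card B.L = B.Q := by rw [BlockChoice.Q, Nat.card_eq_fintype_card]
  have hMF : Module.Finite F B.L := Module.Finite.of_finite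
  have hk : B.Q = Fintype.card F ^ Module.finrank F B.L := by
    rw [← hQ]; exact Module.card_eq_pow_finrank
  have hk0 : 0 < Module.finrank F B.L := Module.finrank_pos
  rw [hQ] at hdvd
  have hcop : ¬ n ∣ B.Q := by
    intro h
    rw [hk] at h
    obtain ⟨p, hpF⟩ := CharP.exists F
    obtain ⟨m, hp', hm⟩ := FiniteField.card F p
    have h2 := hp.dvd_of_dvd_pow h
    rw [hm] at h2
    have h3 := (Nat.prime_dvd_prime_iff_eq hp hp').1 (hp.dvd_of_dvd_pow h2)
    exact hn (by rw [h3]; exact CharP.cast_eq_zero F p)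
  have hsq : B.Q ^ 2 - 1 = (B.Q + 1) * (B.Q - 1) := by rw [← Nat.sq_sub_sq, one_pow]
  have hdvd2 : n ∣ B.Q ^ 2 - 1 := by
    rcases hp.dvd_mul.1 hdvd with h | h
    · simpa using h
    · have h4 : B.Q ^ 2 - B.Q = B.Q * (B.Q - 1) := by rw [Nat.mul_sub, mul_one, pow_two]
      simp only [Fin.val_one, pow_one] at h
      rw [h4] at h
      rw [hsq]
      exact Dvd.dvd.mul_left ((hp.dvd_mul.1 h).resolve_left hcop) _
  have h1 : ((Fintype.card F : ZMod n)) ^ (2 * Module.finrank F B.L) = 1 := by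
    have h5 := (ZMod.natCast_eq_zero_iff _ _).2 hdvd2
    rw [Nat.cast_sub (Nat.one_le_pow _ _ (Nat.zero_lt_of_lt B.one_lt_Q)), sub_eq_zero, hk] at h5
    push_cast at h5
    rw [← h5, ← pow_mul, mul_comm]
  rw [hk, ← pow_mul, mul_comm _ 2]
  exact Nat.pow_le_pow_right Fintype.card_pos (Nat.le_of_dvd (by positivity) (orderOf_dvd_of_pow_eq_one h1))

end Counting

/-! ### Group codes have few words of small weight -/

section Balanced
variable {F : Type u} [Field F] {G : Type} [Group G]

/-- Every group code has an information set. -/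
lemma exists_information_set [Finite G] (I : Ideal (MonoidAlgebra F G)) :
    ∃ S : Finset G, Function.Bijective fun (c : I) (b : S) => (c : MonoidAlgebra F G).coeff b := by
  classical
  have := Fintype.ofFinite G
  let P : Finset G → Prop := fun S => ∀ c ∈ I, (∀ x ∈ S, c.coeff x = 0) → c = 0
  have hP : P Finset.univ := fun c _ h => by ext x; exact h x (Finset.mem_univ x)
  -- A minimal set of coordinates that determines every codeword. If `b` is removed, some nonzero
  -- codeword vanishes on the rest of `S`; rescaled, it is the dual basis vector at `b`.
  obtain ⟨S, hS, hmin⟩ := (wellFounded_lt (α := Finset G)).has_min {S | P S} ⟨_, hP⟩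
  refine ⟨S, ?_, ?_⟩
  · intro c d h
    have := hS (c - d) (I.sub_mem c.2 d.2) fun x hx => by
      simpa [sub_eq_zero] using congrFun h ⟨x, hx⟩
    exact Subtype.ext (sub_eq_zero.1 this)
  · have key : ∀ b ∈ S, ∃ d ∈ I, d.coeff b = 1 ∧ ∀ x ∈ S, x ≠ b → d.coeff x = 0 := by
      intro b hb
      have h : ¬ P (S.erase b) := fun h => hmin _ h (Finset.erase_ssubset hb)
      simp only [P] at h
      push Not at h
      obtain ⟨c, hc, hz, h0⟩ := h
      have hcb : c.coeff b ≠ 0 := by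
        intro h
        apply h0
        refine hS c hc fun x hx => ?_
        by_cases hxb : x = b
        · rw [hxb, h]
        · exact hz x (Finset.mem_erase.2 ⟨hxb, hx⟩)
      refine ⟨(c.coeff b)⁻¹ • c, I.smul_of_tower_mem _ hc, by simp [hcb], fun x hx hxb => ?_⟩
      simp [hz x (Finset.mem_erase.2 ⟨hxb, hx⟩)]
    choose! d hdI hd1 hd0 using key
    intro f
    refine ⟨⟨∑ b : S, f b • d b, I.sum_mem fun b _ => I.smul_of_tower_mem _ (hdI b b.2)⟩, ?_⟩
    funext x
    simp only [MonoidAlgebra.coeff_sum, Finsupp.finsetSum_apply, MonoidAlgebra.coeff_smul,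
      Finsupp.smul_apply, smul_eq_mul]
    rw [Finset.sum_eq_single x, hd1 x x.2, mul_one]
    · intro b _ hb
      rw [hd0 b b.2 x x.2 fun h => hb (Subtype.ext h.symm), mul_zero]
    · simp

open Classical in
-- The weight enumerator of the full space, which factors over the coordinates.
lemma sum_prod_ite [Fintype F] (z : ℝ) {ι : Type*} [Fintype ι] [DecidableEq ι] :
    ∑ f : ι → F, ∏ b, (if f b = 0 then 1 else z) =
      (1 + ((Fintype.card F : ℝ) - 1) * z) ^ Fintype.card ι := by
  rw [← Fintype.piFinset_univ, ← Finset.prod_univ_sum (fun _ => Finset.univ)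
    (fun (_ : ι) (a : F) => if a = 0 then (1 : ℝ) else z)]
  rw [Finset.prod_const, Finset.card_univ]
  congr 1
  rw [← Finset.add_sum_erase _ _ (Finset.mem_univ (0 : F)), if_pos rfl,
    Finset.sum_congr rfl fun a ha => if_neg (Finset.ne_of_mem_erase ha), Finset.sum_const,
    Finset.card_erase_of_mem (Finset.mem_univ _), Finset.card_univ, nsmul_eq_mul,
    Nat.cast_sub Fintype.card_pos, Nat.cast_one]

open Classical in
-- Left translation by `g⁻¹` permutes `I`, so `g S` is again an information set, and restriction to
-- it identifies `I` with the full space.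
lemma sum_prod_translate [Fintype F] [Fintype G] (I : Ideal (MonoidAlgebra F G)) [Fintype I]
    {S : Finset G}
    (hS : Function.Bijective fun (c : I) (b : S) => (c : MonoidAlgebra F G).coeff b) (z : ℝ) (g : G) :
    ∑ c : I, ∏ b : S, (if (c : MonoidAlgebra F G).coeff (g * b) = 0 then 1 else z) =
      (1 + ((Fintype.card F : ℝ) - 1) * z) ^ S.card := by
  rw [← Fintype.card_coe, ← sum_prod_ite (F := F)]
  let T : G → I → I := fun x c => ⟨MonoidAlgebra.single x 1 * (c : MonoidAlgebra F G), I.mul_mem_left _ c.2⟩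
  have hT : ∀ x y c, y * x = 1 → T y (T x c) = c := fun x y c h => Subtype.ext (by
    simp only [T]
    rw [← mul_assoc, MonoidAlgebra.single_mul_single, h, one_mul, ← MonoidAlgebra.one_def, one_mul])
  let e : I ≃ I := ⟨T g⁻¹, T g, fun c => hT _ _ c (mul_inv_cancel g), fun c => hT _ _ c (inv_mul_cancel g)⟩
  let e' : I ≃ (S → F) := e.trans (Equiv.ofBijective _ hS)
  refine Fintype.sum_equiv (M := ℝ) e' _ _ fun c => ?_
  refine Finset.prod_congr rfl fun b _ => ?_
  simp [e', e, T]

open Classical in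
-- Every element of `G` lies in exactly `|S|` of the translates `g S`. So the weight of `c` on `g
-- S`, averaged over `g`, is `|S| * weight c / |G|`, and the inequality of geometric and arithmetic
-- means applies to the powers of `z`.
lemma rpow_le_average [Fintype G] (c : MonoidAlgebra F G) (S : Finset G) {z : ℝ} (hz : 0 < z) :
    z ^ ((S.card * weight c : ℝ) / Fintype.card G) ≤
      ∑ g : G, (Fintype.card G : ℝ)⁻¹ * ∏ b : S, (if c.coeff (g * b) = 0 then 1 else z) := by
  have hN : (Fintype.card G : ℝ) ≠ 0 := by exact_mod_cast Fintype.card_ne_zero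
  have hprod : ∀ g : G, ∏ b : S, (if c.coeff (g * b) = 0 then 1 else z) =
      z ^ (∑ b : S, if c.coeff (g * b) = 0 then (0 : ℝ) else 1) := by
    intro g
    rw [Real.rpow_sum_of_pos hz]
    refine Finset.prod_congr rfl fun b _ => ?_
    split_ifs <;> simp
  have hw : ∀ b : G, ∑ g : G, (if c.coeff (g * b) = 0 then (0 : ℝ) else 1) = weight c := by
    intro b
    refine (Equiv.sum_comp (Equiv.mulRight b) fun x => if c.coeff x = 0 then (0 : ℝ) else 1).trans ?_
    rw [weight]
    rw [Finset.card_eq_sum_ones, Nat.cast_sum, ← Finset.sum_subset (Finset.subset_univ c.coeff.support)]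
    · refine Finset.sum_congr rfl fun x hx => ?_
      rw [if_neg (Finsupp.mem_support_iff.1 hx), Nat.cast_one]
    · intro x _ hx
      rw [if_pos (Finsupp.notMem_support_iff.1 hx)]
  have hexp : (S.card * weight c : ℝ) / Fintype.card G =
      ∑ g : G, (∑ b : S, if c.coeff (g * b) = 0 then (0 : ℝ) else 1) * (Fintype.card G : ℝ)⁻¹ := by
    rw [← Finset.sum_mul, Finset.sum_comm]
    simp only [hw, Finset.sum_const, Finset.card_univ, Fintype.card_coe, nsmul_eq_mul]
    rw [div_eq_mul_inv]
  have := Real.geom_mean_le_arith_mean_weighted Finset.univ (fun _ : G => (Fintype.card G : ℝ)⁻¹)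
    (fun g => ∏ b : S, (if c.coeff (g * b) = 0 then 1 else z)) (fun _ _ => by positivity)
    (by rw [Finset.sum_const, Finset.card_univ, nsmul_eq_mul, mul_inv_cancel₀ hN])
    (fun g _ => Finset.prod_nonneg fun b _ => by split_ifs <;> positivity)
  refine le_trans (le_of_eq ?_) this
  rw [hexp, Real.rpow_sum_of_pos hz]
  refine Finset.prod_congr rfl fun g _ => ?_
  rw [hprod, ← Real.rpow_mul hz.le]

/-- The value `z = δ / ((1 - δ)(q - 1))` minimises the Chernoff bound `(1 + (q - 1) z) z^(-δ)`, and
the minimum is `q^h`. -/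
lemma rpow_qEntropy {q : ℕ} (hq : 1 < q) {δ : ℝ} (h0 : 0 < δ) (h1 : δ < 1) :
    (q : ℝ) ^ qEntropy q δ = (1 + ((q : ℝ) - 1) * (δ / ((1 - δ) * (q - 1)))) *
      (δ / ((1 - δ) * (q - 1))) ^ (-δ) := by
  have hq' : (1 : ℝ) < q := by exact_mod_cast hq
  have hq0 : (0 : ℝ) < q - 1 := by linarith
  have hd : 0 < 1 - δ := by linarith
  have e1 : 1 + ((q : ℝ) - 1) * (δ / ((1 - δ) * (q - 1))) = (1 - δ)⁻¹ := by
    field_simp; ring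
  have hz : 0 < δ / ((1 - δ) * (q - 1)) := by positivity
  rw [e1]
  apply Real.log_injOn_pos (Set.mem_Ioi.2 (by positivity)) (Set.mem_Ioi.2 (by positivity))
  rw [Real.log_rpow (by positivity), Real.log_mul (by positivity) (by positivity), Real.log_inv,
    Real.log_rpow hz, Real.log_div (by positivity) (by positivity), Real.log_mul (by positivity) (by positivity),
    qEntropy]
  have hl : Real.log q ≠ 0 := (Real.log_pos hq').ne'
  simp only [Real.logb]
  field_simp
  ring

/-- Group codes have few words of small weight. -/
lemma ncard_weight_le [Fintype F] [Finite G] (I : Ideal (MonoidAlgebra F G)) {δ : ℝ} (h0 : 0 < δ)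
    (h1 : δ < 1 - (Fintype.card F : ℝ)⁻¹) :
    ({c : MonoidAlgebra F G | c ∈ I ∧ (weight c : ℝ) ≤ δ * Nat.card G}.ncard : ℝ) ≤
      (Nat.card I : ℝ) ^ qEntropy (Fintype.card F) δ := by
  classical
  have := Fintype.ofFinite G
  have hfin : Finite (MonoidAlgebra F G) := finite_monoidAlgebra
  have := Fintype.ofFinite I
  obtain ⟨S, hS⟩ := exists_information_set I
  set q := Fintype.card F with hqdef
  have hq : 1 < q := Fintype.one_lt_card
  have hq' : (1 : ℝ) < q := by exact_mod_cast hq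
  have hδ1 : δ < 1 := h1.trans (by simp; positivity)
  have hN : (0 : ℝ) < Fintype.card G := by exact_mod_cast Fintype.card_pos
  have hd : 0 < 1 - δ := by linarith
  have hq0 : (0 : ℝ) < q - 1 := by linarith
  set z : ℝ := δ / ((1 - δ) * (q - 1)) with hz
  have hz0 : 0 < z := by positivity
  -- This is where `δ < 1 - 1/q` enters: for `z ≤ 1` small weight makes `z ^ weight` large.
  have hz1 : z ≤ 1 := by
    rw [hz, div_le_one (by positivity)]
    have : δ * q < q - 1 := by
      calc δ * q < (1 - (q : ℝ)⁻¹) * q := by gcongr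
        _ = q - 1 := by field_simp
    linarith
  have hcard : (Nat.card I : ℝ) = (q : ℝ) ^ S.card := by
    rw [Nat.card_congr (Equiv.ofBijective _ hS), Nat.card_fun, Nat.card_eq_fintype_card,
      Nat.card_eq_fintype_card, Fintype.card_coe]
    push_cast
    rfl
  set L : Finset I := Finset.univ.filter fun c => (weight (c : MonoidAlgebra F G) : ℝ) ≤ δ * Nat.card G
  have hL : {c : MonoidAlgebra F G | c ∈ I ∧ (weight c : ℝ) ≤ δ * Nat.card G}.ncard = L.card := by
    rw [← Set.ncard_coe_finset, ← Set.ncard_image_of_injective _ Subtype.val_injective]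
    congr 1
    ext c
    simp [L, and_comm]
  -- Chernoff bound: each light word contributes at least `z^(δ|S|)` to the enumerator averaged over
  -- all translates of `S`.
  have hmain : (L.card : ℝ) * z ^ (δ * S.card) ≤ (1 + ((q : ℝ) - 1) * z) ^ S.card := by
    calc (L.card : ℝ) * z ^ (δ * S.card) = ∑ c ∈ L, z ^ (δ * S.card) := by
          rw [Finset.sum_const, nsmul_eq_mul]
      _ ≤ ∑ c ∈ L, ∑ g : G, (Fintype.card G : ℝ)⁻¹ *
            ∏ b : S, (if (c : MonoidAlgebra F G).coeff (g * b) = 0 then 1 else z) := by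
          refine Finset.sum_le_sum fun c hc => le_trans ?_ (rpow_le_average _ S hz0)
          apply Real.rpow_le_rpow_of_exponent_ge hz0 hz1
          rw [div_le_iff₀ hN]
          have h2 : (weight (c : MonoidAlgebra F G) : ℝ) ≤ δ * Nat.card G := (Finset.mem_filter.1 hc).2
          rw [Nat.card_eq_fintype_card] at h2
          calc (S.card * weight (c : MonoidAlgebra F G) : ℝ) ≤ S.card * (δ * Fintype.card G) := by gcongr
            _ = _ := by ring
      _ ≤ ∑ c : I, ∑ g : G, (Fintype.card G : ℝ)⁻¹ *
            ∏ b : S, (if (c : MonoidAlgebra F G).coeff (g * b) = 0 then 1 else z) := by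
          refine Finset.sum_le_sum_of_subset_of_nonneg (Finset.subset_univ _) fun c _ _ => ?_
          refine Finset.sum_nonneg fun g _ => mul_nonneg (by positivity) ?_
          exact Finset.prod_nonneg fun b _ => by split_ifs <;> positivity
      _ = (1 + ((q : ℝ) - 1) * z) ^ S.card := by
          rw [Finset.sum_comm]
          simp only [← Finset.mul_sum, sum_prod_translate I hS z]
          rw [Finset.sum_const, Finset.card_univ, nsmul_eq_mul, ← mul_assoc,
            inv_mul_cancel₀ hN.ne', one_mul]
  rw [hL, hcard, ← Real.rpow_natCast, ← Real.rpow_mul (by positivity), mul_comm (S.card : ℝ),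
    Real.rpow_mul (by positivity), Real.rpow_natCast, rpow_qEntropy hq h0 hδ1, ← hz, mul_pow,
    ← Real.rpow_natCast (z ^ (-δ)), ← Real.rpow_mul hz0.le, neg_mul, Real.rpow_neg hz0.le,
    ← div_eq_mul_inv, le_div_iff₀ (by positivity)]
  exact hmain

end Balanced

/-! ### Primes modulo which `q` has large order -/

section Primes

/-- Crude: a number with `k` distinct prime factors is at least `2^k`, and `q^d ≤ 2^(q d)`. -/
lemma card_primeFactors_pow_sub_one_le (q d : ℕ) (hq : 1 < q) (hd : d ≠ 0) :
    (q ^ d - 1).primeFactors.card ≤ q * d := by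
  have h1 : 1 < q ^ d := Nat.one_lt_pow hd hq
  have h2 : 2 ^ (q ^ d - 1).primeFactors.card ≤ q ^ d - 1 := by
    calc 2 ^ (q ^ d - 1).primeFactors.card ≤ ∏ p ∈ (q ^ d - 1).primeFactors, p :=
          Finset.pow_card_le_prod _ _ _ fun p hp => (Nat.prime_of_mem_primeFactors hp).two_le
      _ ≤ q ^ d - 1 := Nat.le_of_dvd (by omega) (Nat.prod_primeFactors_dvd _)
  have h3 : 2 ^ (q ^ d - 1).primeFactors.card < 2 ^ (q * d) := by
    calc _ < q ^ d := by omega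
      _ ≤ (2 ^ q) ^ d := Nat.pow_le_pow_left (Nat.lt_two_pow_self).le d
      _ = _ := (pow_mul ..).symm
  exact ((Nat.pow_lt_pow_iff_right (by norm_num)).1 h3).le

/-- The primes modulo which `q` has small order. -/
def smallOrderPrimes (q : ℕ) : Set ℕ := {p | p.Prime ∧ q < p ∧ orderOf (q : ZMod p) ^ 3 < p}

lemma orderOf_pos_of_lt {q p : ℕ} (hq : 1 < q) (hp : p.Prime) (h : q < p) :
    0 < orderOf (q : ZMod p) := by
  have := Fact.mk hp
  rw [orderOf_pos_iff, isOfFinOrder_iff_pow_eq_one]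
  refine ⟨p - 1, Nat.sub_pos_of_lt hp.one_lt, ZMod.pow_card_sub_one_eq_one ?_⟩
  rw [Ne, ZMod.natCast_eq_zero_iff]
  exact fun hd => absurd (Nat.le_of_dvd (by omega) hd) (by omega)

/-- The primes modulo which `q` has small order are sparse. -/
lemma summable_small_order (q : ℕ) (hq : 1 < q) :
    Summable (fun p : smallOrderPrimes q => 1 / ((p : ℕ) : ℝ)) := by
  classical
  have hs : Summable fun d : ℕ => (q : ℝ) * (1 / (d : ℝ) ^ 2) :=
    (Real.summable_one_div_nat_pow.2 (by norm_num)).mul_left _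
  refine summable_of_sum_le (c := ∑' d : ℕ, (q : ℝ) * (1 / (d : ℝ) ^ 2)) (fun p => by positivity) ?_
  intro u
  let o : smallOrderPrimes q → ℕ := fun p => orderOf (q : ZMod (p : ℕ))
  have ho : ∀ p, 0 < o p := fun p => orderOf_pos_of_lt hq p.2.1 p.2.2.1
  have hdvd : ∀ p : smallOrderPrimes q, (p : ℕ) ∣ q ^ o p - 1 := by
    intro p
    rw [← ZMod.natCast_eq_zero_iff, Nat.cast_sub (Nat.one_le_pow _ _ (by omega))]
    push_cast
    rw [pow_orderOf_eq_one, sub_self]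
  -- Group the primes by the order `d` of `q`. They divide `q^d - 1`, so there are at most `q d` of
  -- them; each exceeds `d³`, so the group contributes at most `q / d²`.
  rw [← Finset.sum_fiberwise_of_maps_to (g := o) (t := u.image o) fun p hp => Finset.mem_image_of_mem o hp]
  refine le_trans (Finset.sum_le_sum fun d hd => ?_) (hs.sum_le_tsum (u.image o) fun d _ => by positivity)
  obtain ⟨p0, -, hp0⟩ := Finset.mem_image.1 hd
  have hd0 : 0 < d := hp0 ▸ ho p0
  have hcard : (u.filter fun p => o p = d).card ≤ q * d := by
    rw [← Finset.card_image_of_injective _ Subtype.val_injective]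
    refine le_trans (Finset.card_le_card ?_) (card_primeFactors_pow_sub_one_le q d hq hd0.ne')
    intro p hp
    obtain ⟨p, hp', rfl⟩ := Finset.mem_image.1 hp
    have hp := (Finset.mem_filter.1 hp').2
    rw [Nat.mem_primeFactors]
    refine ⟨p.2.1, hp ▸ hdvd p, ?_⟩
    have := Nat.one_lt_pow hd0.ne' hq
    omega
  calc ∑ p ∈ u with o p = d, 1 / ((p : ℕ) : ℝ) ≤ ∑ p ∈ u with o p = d, 1 / (d : ℝ) ^ 3 := by
        refine Finset.sum_le_sum fun p hp => ?_
        have hp := (Finset.mem_filter.1 hp).2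
        have h3 : d ^ 3 < (p : ℕ) := by rw [← hp]; exact p.2.2.2
        have h4 : ((d : ℝ) ^ 3) ≤ (p : ℕ) := by exact_mod_cast h3.le
        exact one_div_le_one_div_of_le (by positivity) h4
    _ = ((u.filter fun p => o p = d).card : ℝ) * (1 / (d : ℝ) ^ 3) := by
        rw [Finset.sum_const, nsmul_eq_mul]
    _ ≤ (q * d : ℝ) * (1 / (d : ℝ) ^ 3) := by
        gcongr
        exact_mod_cast hcard
    _ = _ := by field_simp

/-- There are infinitely many primes modulo which `q` has large order. -/
lemma exists_prime_large_order (q : ℕ) (hq : 1 < q) (N : ℕ) :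
    ∃ p, p.Prime ∧ N < p ∧ p ≤ orderOf (q : ZMod p) ^ 3 := by
  by_contra! h
  apply not_summable_one_div_on_primes
  -- Were the claim false, every prime beyond `max q N` would have small order, and the sum of the
  -- reciprocals of all primes would converge.
  have h1 := summable_subtype_iff_indicator (f := fun p : ℕ => 1 / (p : ℝ))|>.1 (summable_small_order q hq)
  refine (summable_congr_cofinite ?_).1 h1
  rw [Filter.EventuallyEq, Filter.eventually_cofinite]
  refine (Set.finite_le_nat (max q N)).subset fun p hp => ?_
  by_contra hlt
  simp only [Set.mem_ofPred_eq, not_le] at hlt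
  apply hp
  have hqp := (le_max_left q N).trans_lt hlt
  have hNp := (le_max_right q N).trans_lt hlt
  by_cases hpp : p.Prime
  · rw [Set.indicator_of_mem, Set.indicator_of_mem]
    · exact hpp
    · exact ⟨hpp, hqp, h p hpp hNp⟩
  · rw [Set.indicator_of_notMem, Set.indicator_of_notMem]
    · exact hpp
    · exact fun h => hpp h.1

end Primes

/-! ### The union bound and its limit -/

section Probability
variable {F : Type u} [Field F] {n : ℕ}

/-- All coefficients of `ê₀` equal `1/n`. Multiples of `ê₀` lie in every code `α Ĉ β`, and full
weight makes them harmless. -/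
lemma weight_smul_e0hat [NeZero n] (hn : (n : F) ≠ 0) {c : F} (hc : c ≠ 0) :
    weight (c • e0hat F n) = 2 * n := by
  classical
  have h : ∀ x : DihedralGroup n, (c • e0hat F n).coeff x ≠ 0 := by
    intro x
    have hv : ∀ x, (reflv F n * e0 F n).coeff x = (e0 F n).coeff (sr 0 * x) := by
      intro x
      simp [reflv]
    cases x with
    | r i =>
      rw [MonoidAlgebra.coeff_smul, e0hat, MonoidAlgebra.coeff_add, Finsupp.smul_apply,
        Finsupp.add_apply, hv, coeff_e0_r, sr_mul_r, coeff_sr_of_mem_FH e0_mem_FH]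
      simp [hc, hn]
    | sr i =>
      rw [MonoidAlgebra.coeff_smul, e0hat, MonoidAlgebra.coeff_add, Finsupp.smul_apply,
        Finsupp.add_apply, hv, sr_mul_sr, coeff_e0_r, coeff_sr_of_mem_FH e0_mem_FH]
      simp [hc, hn]
  have hs : (c • e0hat F n).coeff.support = Finset.univ := by
    ext x
    simp only [Finsupp.mem_support_iff, Finset.mem_univ, iff_true]
    exact h x
  rw [weight, hs, Finset.card_univ, DihedralGroup.card]

variable [NeZero n] [CharP F 2]

/-- A code of small relative minimum distance contains a word of small weight outside `F ê₀`. -/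
lemma exists_small_weight [Finite F] [Fintype (blockIds F n)] (hn : (n : F) ≠ 0)
    {B : ∀ ε : blockIds F n, BlockChoice F n (ε : FG F n)} {α β : FG F n} (hα : α ∈ Kstar B)
    (hβ : β ∈ Kstar B) {δ : ℝ} (hδ : δ < 1) (h : relMinDist (randomCode B α β) ≤ δ) :
    ∃ y ∈ randomCode B α β, blockSupport y ≠ ∅ ∧
      (weight y : ℝ) ≤ δ * Nat.card (DihedralGroup n) := by
  obtain ⟨I, hI⟩ := isGroupCode_randomCode hn hα hβ
  obtain ⟨β', hβ', h1, h2⟩ := exists_inv_mem_Kstar hn hβ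
  have he0 := Kstar_mul_e0 hn hβ'
  have hcard : (0 : ℝ) < Nat.card (DihedralGroup n) := by exact_mod_cast Nat.card_pos
  have hmem : e0hat F n ∈ I := by
    change e0hat F n ∈ (I : Set (FG F n))
    rw [hI, mem_randomCode_iff hn hα h1 h2]
    have : e0hat F n * β' = e0hat F n := by
      rw [e0hat_eq, (e0_commute _).eq, mul_assoc, (e0_commute β').eq, he0]
    rw [this]
    exact Submodule.mem_sup_left (Submodule.mem_span_singleton_self _)
  -- The words `ê₀` and 0 are distinct, so the minimum distance is attained and is not the default
  -- value `sInf ∅ = 0`.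
  have hne : {d | ∃ c ∈ (I : Set (FG F n)), ∃ c' ∈ (I : Set (FG F n)), c ≠ c' ∧ d = weight (c - c')}.Nonempty :=
    ⟨_, _, hmem, 0, I.zero_mem, e0hat_ne_zero hn, rfl⟩
  obtain ⟨c, hc, c', hc', hcc, hd⟩ := Nat.sInf_mem hne
  rw [← hI] at h ⊢
  have hw : (weight (c - c') : ℝ) ≤ δ * Nat.card (DihedralGroup n) := by
    rw [relMinDist, div_le_iff₀ hcard, minDist, hd] at h
    exact h
  -- With empty block support, `y = y e₀`; as a word of the code it is then a nonzero multiple of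
  -- `ê₀`, of weight `2n > δ * 2n`.
  refine ⟨c - c', I.sub_mem hc hc', fun hs => ?_, hw⟩
  set y := c - c' with hy
  have hy0 : y ≠ 0 := sub_ne_zero.2 hcc
  have hyε : ∀ ε : blockIds F n, y * (ε : FG F n) = 0 := by
    intro ε
    have : ε ∉ blockSupport y := by rw [hs]; simp
    simpa [blockSupport] using this
  have hye : y = y * e0 F n := by
    conv_lhs => rw [← mul_one y, ← block_sum (F := F) hn, mul_add, Finset.mul_sum,
      Finset.sum_eq_zero fun ε _ => hyε ε, add_zero]
  have hyI : y ∈ (I : Set (FG F n)) := I.sub_mem hc hc'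
  rw [hI, mem_randomCode_iff hn hα h1 h2, mem_Chat_iff hn] at hyI
  have hy1 := hyI.1
  rw [mul_assoc, e0hat_eq, ← mul_assoc β', he0, ← e0hat_eq] at hy1
  obtain ⟨k, hk⟩ := (mul_e0hat_eq_zero_iff hn).1 hy1
  rw [← hye] at hk
  have hk0 : k ≠ 0 := by
    rintro rfl
    exact hy0 (by rw [hk, zero_smul])
  rw [hk, weight_smul_e0hat hn hk0, ← DihedralGroup.nat_card] at hw
  nlinarith

open Classical in
/-- Union bound for the proportion of bad codes. -/
lemma ncard_bad_le [Fintype F] [Fintype (blockIds F n)] (hn : (n : F) ≠ 0)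
    (B : ∀ ε : blockIds F n, BlockChoice F n (ε : FG F n)) {δ : ℝ} (h0 : 0 < δ)
    (h1 : δ < 1 - (Fintype.card F : ℝ)⁻¹) (hh0 : 0 < qEntropy (Fintype.card F) δ) :
    ({p ∈ Kstar B ×ˢ Kstar B | relMinDist (randomCode B p.1 p.2) ≤ δ}.ncard : ℝ) ≤
      ((Kstar B).ncard : ℝ) ^ 2 * ((Fintype.card F : ℝ) ^ (2 * qEntropy (Fintype.card F) δ) *
        (∏ ε, (1 + ((B ε).Q : ℝ) ^ (4 * qEntropy (Fintype.card F) δ - 1)) - 1)) := by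
  have hfG : Finite (FG F n) := finite_monoidAlgebra
  have := Fintype.ofFinite (FG F n)
  set h := qEntropy (Fintype.card F) δ with hh
  have hδ1 : δ < 1 := h1.trans_le (by simp)
  have hQ : ∀ ε, (0 : ℝ) < (B ε).Q := fun ε => by exact_mod_cast (zero_lt_one.trans (B ε).one_lt_Q)
  have hK := ncard_Kstar_pos hn B
  obtain ⟨α₀, hα₀⟩ := (Set.ncard_pos (Set.toFinite _)).1 hK
  set K : ℝ := ((Kstar B).ncard : ℝ) with hKdef
  set W : Finset (FG F n) := Finset.univ.filter fun y =>
    blockSupport y ≠ ∅ ∧ (weight y : ℝ) ≤ δ * Nat.card (DihedralGroup n) with hW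
  set N : FG F n → Set (FG F n) := fun y => {β | β ∈ Kstar B ∧ y ∈ randomCode B α₀ β} with hN
  -- The code does not depend on `α`, so a single `α₀` can be used to describe the bad `β`.
  have hsub : {p ∈ Kstar B ×ˢ Kstar B | relMinDist (randomCode B p.1 p.2) ≤ δ} ⊆
      ⋃ y ∈ W, Kstar B ×ˢ N y := by
    rintro ⟨α, β⟩ ⟨⟨hα, hβ⟩, hd⟩
    obtain ⟨y, hy, hs, hw⟩ := exists_small_weight hn hα hβ hδ1 hd
    obtain ⟨β', -, k1, k2⟩ := exists_inv_mem_Kstar hn hβ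
    simp only [Set.mem_iUnion]
    refine ⟨y, by simp [hW, hs]; simpa using hw, hα, hβ, ?_⟩
    change y ∈ randomCode B α₀ β
    rw [mem_randomCode_iff hn hα₀ k1 k2, ← mem_randomCode_iff hn hα k1 k2]
    exact hy
  have hNle : ∀ y, ((N y).ncard : ℝ) ≤ K * (∏ ε ∈ blockSupport y, ((B ε).Q : ℝ))⁻¹ := by
    intro y
    rw [← div_eq_mul_inv, le_div_iff₀ (Finset.prod_pos fun ε _ => hQ ε)]
    have := ncard_mul_prod_le hn B α₀ y
    rw [hKdef]
    exact_mod_cast this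
  have hlow : ∀ T : Finset (blockIds F n), ((W.filter fun y => blockSupport y = T).card : ℝ) ≤
      (Fintype.card F : ℝ) ^ (2 * h) * ∏ ε ∈ T, ((B ε).Q : ℝ) ^ (4 * h) := by
    intro T
    have e1 : ((W.filter fun y => blockSupport y = T).card : ℝ) ≤
        ({c : FG F n | c ∈ blockIdeal T ∧ (weight c : ℝ) ≤ δ * Nat.card (DihedralGroup n)}.ncard : ℝ) := by
      rw [← Set.ncard_coe_finset]
      refine Nat.cast_le.2 (Set.ncard_le_ncard ?_ (Set.toFinite _))
      intro y hy
      rw [Finset.mem_coe, Finset.mem_filter, hW, Finset.mem_filter] at hy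
      refine ⟨fun ε hε => ?_, hy.1.2.2⟩
      rw [← hy.2] at hε
      simpa [blockSupport] using hε
    refine e1.trans ((ncard_weight_le (blockIdeal T) h0 h1).trans ?_)
    have e2 : (Nat.card (blockIdeal T) : ℝ) ≤ (Fintype.card F : ℝ) ^ 2 * ∏ ε ∈ T, ((B ε).Q : ℝ) ^ 4 := by
      have := card_blockIdeal_le hn B T
      rw [Nat.card_eq_fintype_card (α := F)] at this
      exact_mod_cast this
    refine (Real.rpow_le_rpow (by positivity) e2 hh0.le).trans (le_of_eq ?_)
    rw [Real.mul_rpow (by positivity) (Finset.prod_nonneg fun ε _ => by positivity),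
      ← Real.finsetProd_rpow _ _ fun ε _ => by positivity]
    congr 1
    · rw [← Real.rpow_natCast, ← Real.rpow_mul (by positivity)]; norm_num
    · refine Finset.prod_congr rfl fun ε _ => ?_
      rw [← Real.rpow_natCast, ← Real.rpow_mul (by positivity)]; norm_num
  -- Expanding the product gives the sum over all subsets `T`; the term 1 of the empty set is
  -- removed.
  have hsum : ∑ T : Finset (blockIds F n) with T ≠ ∅, ∏ ε ∈ T, ((B ε).Q : ℝ) ^ (4 * h - 1) =
      ∏ ε, (1 + ((B ε).Q : ℝ) ^ (4 * h - 1)) - 1 := by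
    rw [Finset.prod_one_add, Finset.powerset_univ,
      ← Finset.add_sum_erase _ _ (Finset.mem_univ (∅ : Finset (blockIds F n)))]
    rw [Finset.prod_empty, add_sub_cancel_left]
    congr 1
    ext T
    simp
  calc ({p ∈ Kstar B ×ˢ Kstar B | relMinDist (randomCode B p.1 p.2) ≤ δ}.ncard : ℝ)
      ≤ ((⋃ y ∈ W, Kstar B ×ˢ N y).ncard : ℝ) := by
        exact_mod_cast Set.ncard_le_ncard hsub (Set.toFinite _)
    _ ≤ ∑ y ∈ W, ((Kstar B ×ˢ N y).ncard : ℝ) := by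
        exact_mod_cast Finset.set_ncard_biUnion_le W _
    _ ≤ ∑ y ∈ W, K * (K * (∏ ε ∈ blockSupport y, ((B ε).Q : ℝ))⁻¹) := by
        refine Finset.sum_le_sum fun y _ => ?_
        rw [Set.ncard_prod, Nat.cast_mul]
        exact mul_le_mul_of_nonneg_left (hNle y) (by positivity)
    _ = K ^ 2 * ∑ y ∈ W, (∏ ε ∈ blockSupport y, ((B ε).Q : ℝ))⁻¹ := by
        rw [Finset.mul_sum]
        exact Finset.sum_congr rfl fun y _ => by ring
    _ = K ^ 2 * ∑ T : Finset (blockIds F n) with T ≠ ∅, ∑ y ∈ W with blockSupport y = T,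
          (∏ ε ∈ blockSupport y, ((B ε).Q : ℝ))⁻¹ := by
        rw [Finset.sum_fiberwise_of_maps_to]
        intro y hy
        simpa using (Finset.mem_filter.1 hy).2.1
    _ ≤ K ^ 2 * ∑ T : Finset (blockIds F n) with T ≠ ∅, (Fintype.card F : ℝ) ^ (2 * h) *
          ∏ ε ∈ T, ((B ε).Q : ℝ) ^ (4 * h - 1) := by
        refine mul_le_mul_of_nonneg_left (Finset.sum_le_sum fun T _ => ?_) (by positivity)
        rw [Finset.sum_congr rfl fun y hy => by rw [(Finset.mem_filter.1 hy).2], Finset.sum_const, nsmul_eq_mul]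
        refine (mul_le_mul_of_nonneg_right (hlow T) ?_).trans (le_of_eq ?_)
        · exact inv_nonneg.2 (Finset.prod_nonneg fun ε _ => (hQ ε).le)
        · rw [mul_assoc, ← Finset.prod_inv_distrib, ← Finset.prod_mul_distrib]
          congr 1
          refine Finset.prod_congr rfl fun ε _ => ?_
          rw [Real.rpow_sub (hQ ε), Real.rpow_one, div_eq_mul_inv]
    _ = _ := by rw [← Finset.mul_sum, hsum]

omit [CharP F 2] in
lemma probGT_le_one [Finite F] (B : ∀ ε : blockIds F n, BlockChoice F n (ε : FG F n)) (δ : ℝ) :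
    probGT B δ ≤ 1 := by
  have hfG : Finite (FG F n) := finite_monoidAlgebra
  refine div_le_one_of_le₀ ?_ (by positivity)
  exact Nat.cast_le.2 (Set.ncard_le_ncard (Set.sep_subset _ _) (Set.toFinite _))

/-- There are at most `2n ≤ 2s³` blocks. As `4h - 1 < 0`, the bound `Q² ≥ q^s` gives `Q^(4h-1) ≤
(q^((4h-1)/2))^s`, and `1 + x ≤ exp x` turns the product into an exponential. -/
lemma le_probGT [Fintype F] (hp : n.Prime) (hn : (n : F) ≠ 0)
    (B : ∀ ε : blockIds F n, BlockChoice F n (ε : FG F n)) {δ : ℝ} (h0 : 0 < δ)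
    (h1 : δ < 1 - (Fintype.card F : ℝ)⁻¹) (hh0 : 0 < qEntropy (Fintype.card F) δ)
    (hh1 : qEntropy (Fintype.card F) δ < 1 / 4) {s : ℕ} (hs : s = orderOf (Fintype.card F : ZMod n))
    (hns : n ≤ s ^ 3) :
    1 - (Fintype.card F : ℝ) ^ (2 * qEntropy (Fintype.card F) δ) *
      (Real.exp (2 * ((s : ℝ) ^ 3 *
        ((Fintype.card F : ℝ) ^ ((4 * qEntropy (Fintype.card F) δ - 1) / 2)) ^ s)) - 1) ≤
      probGT B δ := by
  have hfG : Finite (FG F n) := finite_monoidAlgebra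
  have := Fintype.ofFinite (blockIds F n)
  set h := qEntropy (Fintype.card F) δ with hh
  set x : ℝ := ((Fintype.card F : ℝ) ^ ((4 * h - 1) / 2)) ^ s with hx
  have hx0 : 0 ≤ x := by positivity
  have hK : (0 : ℝ) < (Kstar B).ncard := by exact_mod_cast ncard_Kstar_pos hn B
  have hbad := ncard_bad_le hn B h0 h1 hh0
  rw [← hh] at hbad
  have hQx : ∀ ε, ((B ε).Q : ℝ) ^ (4 * h - 1) ≤ x := by
    intro ε
    have e1 := pow_orderOf_le_Q_sq hp hn ε.2 (B ε)
    rw [← hs] at e1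
    have e2 : ((Fintype.card F : ℝ)) ^ s ≤ ((B ε).Q : ℝ) ^ 2 := by exact_mod_cast e1
    have hF : (0 : ℝ) < Fintype.card F := by exact_mod_cast Fintype.card_pos
    calc ((B ε).Q : ℝ) ^ (4 * h - 1) = (((B ε).Q : ℝ) ^ 2) ^ ((4 * h - 1) / 2) := by
          rw [← Real.rpow_natCast, ← Real.rpow_mul (by positivity)]
          congr 1
          push_cast
          ring
      _ ≤ ((Fintype.card F : ℝ) ^ s) ^ ((4 * h - 1) / 2) :=
          Real.rpow_le_rpow_of_nonpos (by positivity) e2 (by linarith)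
      _ = x := by
          rw [hx, ← Real.rpow_natCast, ← Real.rpow_natCast, ← Real.rpow_mul hF.le,
            ← Real.rpow_mul hF.le, mul_comm]
  have hprod : ∏ ε, (1 + ((B ε).Q : ℝ) ^ (4 * h - 1)) ≤ Real.exp (2 * ((s : ℝ) ^ 3 * x)) := by
    calc ∏ ε, (1 + ((B ε).Q : ℝ) ^ (4 * h - 1)) ≤ ∏ _ε : blockIds F n, Real.exp x := by
          refine Finset.prod_le_prod (fun ε _ => by positivity) fun ε _ => ?_
          rw [add_comm]
          exact (add_le_add_left (hQx ε) 1).trans (Real.add_one_le_exp x)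
      _ = Real.exp (Fintype.card (blockIds F n) * x) := by
          rw [Finset.prod_const, Finset.card_univ, ← Real.exp_nat_mul]
      _ ≤ Real.exp (2 * ((s : ℝ) ^ 3 * x)) := by
          apply Real.exp_le_exp.2
          have e3 : (Fintype.card (blockIds F n) : ℝ) ≤ 2 * (s : ℝ) ^ 3 := by
            exact_mod_cast card_blockIds_le.trans (Nat.mul_le_mul_left 2 hns)
          calc _ ≤ 2 * (s : ℝ) ^ 3 * x := mul_le_mul_of_nonneg_right e3 hx0
            _ = _ := by ring
  have hcompl : ({p ∈ Kstar B ×ˢ Kstar B | δ < relMinDist (randomCode B p.1 p.2)}.ncard : ℝ) +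
      ({p ∈ Kstar B ×ˢ Kstar B | relMinDist (randomCode B p.1 p.2) ≤ δ}.ncard : ℝ) =
      ((Kstar B).ncard : ℝ) ^ 2 := by
    have e4 : {p ∈ Kstar B ×ˢ Kstar B | δ < relMinDist (randomCode B p.1 p.2)} ∪
        {p ∈ Kstar B ×ˢ Kstar B | relMinDist (randomCode B p.1 p.2) ≤ δ} = Kstar B ×ˢ Kstar B := by
      ext p
      simp only [Set.mem_union, Set.mem_ofPred_eq, ← and_or_left, and_iff_left_iff_imp]
      exact fun _ => lt_or_ge _ _
    have e5 : Disjoint {p ∈ Kstar B ×ˢ Kstar B | δ < relMinDist (randomCode B p.1 p.2)}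
        {p ∈ Kstar B ×ˢ Kstar B | relMinDist (randomCode B p.1 p.2) ≤ δ} :=
      Set.disjoint_left.2 fun p h1 h2 => absurd h1.2 (not_lt.2 h2.2)
    rw [← Nat.cast_add, ← Set.ncard_union_eq e5 (Set.toFinite _) (Set.toFinite _), e4, Set.ncard_prod,
      Nat.cast_mul, pow_two]
  rw [probGT, Set.ncard_prod, Nat.cast_mul, ← pow_two, le_div_iff₀ (by positivity), sub_mul, one_mul]
  have hfin : ({p ∈ Kstar B ×ˢ Kstar B | relMinDist (randomCode B p.1 p.2) ≤ δ}.ncard : ℝ) ≤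
      (Fintype.card F : ℝ) ^ (2 * h) * (Real.exp (2 * ((s : ℝ) ^ 3 * x)) - 1) * ((Kstar B).ncard : ℝ) ^ 2 := by
    refine hbad.trans ?_
    rw [mul_comm]
    gcongr
  linarith

end Probability

/-- Because `h < 1/4`, the base `q^((4h-1)/2)` is less than 1, and its `s`-th power outweighs the
factor `s³` contributed by the number of blocks. -/
lemma tendsto_probGT_bound {q : ℕ} (hq : 1 < q) {h : ℝ} (hh1 : h < 1 / 4) {s : ℕ → ℕ}
    (hs : Filter.Tendsto s Filter.atTop Filter.atTop) :
    Filter.Tendsto (fun i => 1 - (q : ℝ) ^ (2 * h) *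
      (Real.exp (2 * ((s i : ℝ) ^ 3 * ((q : ℝ) ^ ((4 * h - 1) / 2)) ^ (s i))) - 1))
      Filter.atTop (nhds 1) := by
  have hq' : (1 : ℝ) < q := by exact_mod_cast hq
  set r : ℝ := (q : ℝ) ^ ((4 * h - 1) / 2) with hr
  have hr0 : 0 ≤ r := by positivity
  have hr1 : r < 1 := Real.rpow_lt_one_of_one_lt_of_neg hq' (by linarith)
  have h1 : Filter.Tendsto (fun i => (s i : ℝ) ^ 3 * r ^ (s i)) Filter.atTop (nhds 0) :=
    (tendsto_pow_const_mul_const_pow_of_abs_lt_one 3 (by rwa [abs_of_nonneg hr0])).comp hs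
  have h2 : Filter.Tendsto (fun i => 2 * ((s i : ℝ) ^ 3 * r ^ (s i))) Filter.atTop (nhds 0) := by
    simpa using h1.const_mul 2
  have h3 : Filter.Tendsto (fun i => Real.exp (2 * ((s i : ℝ) ^ 3 * r ^ (s i)))) Filter.atTop (nhds 1) := by
    simpa [Function.comp_def] using (Real.continuous_exp.tendsto 0).comp h2
  simpa using ((h3.sub_const 1).const_mul ((q : ℝ) ^ (2 * h))).const_sub 1

end DihedralCode

end

/-! ### The main theorem -/

theorem theorem1p1 (F : Type u) [Field F] [Fintype F] [CharP F 2] (δ : ℝ)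
    (hδ0 : 0 < δ) (hδ1 : δ < 1 - (Fintype.card F : ℝ)⁻¹)
    (hh0 : 0 < DihedralCode.qEntropy (Fintype.card F) δ)
    (hh1 : DihedralCode.qEntropy (Fintype.card F) δ < 1 / 4) :
    (∃ (n : ℕ → ℕ) (C : ∀ i, Ideal (MonoidAlgebra F (DihedralGroup (n i)))),
      (∀ i, 1 < n i) ∧
      Filter.Tendsto (fun i => Nat.card (DihedralGroup (n i))) Filter.atTop Filter.atTop ∧
      ∀ i, DihedralCode.IsSelfDual (C i : Set (MonoidAlgebra F (DihedralGroup (n i)))) ∧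
        δ < DihedralCode.relMinDist (C i : Set (MonoidAlgebra F (DihedralGroup (n i))))) ∧
    (∃ n : ℕ → ℕ,
      (∀ i, 1 < n i ∧ Odd (n i) ∧ (n i).Coprime (Fintype.card F)) ∧
      Filter.Tendsto n Filter.atTop Filter.atTop ∧
      (∀ i, ∀ ε ∈ DihedralCode.blockIds F (n i),
        Nonempty (DihedralCode.BlockChoice F (n i) ε)) ∧
      ∀ B : ∀ i, ∀ ε : DihedralCode.blockIds F (n i),
          DihedralCode.BlockChoice F (n i) (ε : DihedralCode.FG F (n i)),
        (∀ i, ∀ α ∈ DihedralCode.Kstar (B i), ∀ β ∈ DihedralCode.Kstar (B i),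
          DihedralCode.IsGroupCode (DihedralCode.randomCode (B i) α β) ∧
          DihedralCode.IsSelfDual (DihedralCode.randomCode (B i) α β)) ∧
        Filter.Tendsto (fun i => DihedralCode.probGT (B i) δ) Filter.atTop (nhds 1)) := by
  have hq : 1 < Fintype.card F := Fintype.one_lt_card
  -- Primes `n i` beyond both `i` and `q`: the first forces `n i → ∞`, the second makes `n i` odd
  -- and coprime to `q`.
  choose n hprime hgt hord using fun i : ℕ =>
    DihedralCode.exists_prime_large_order (Fintype.card F) hq (max i (Fintype.card F))
  have hi : ∀ i, i < n i := fun i => (le_max_left _ _).trans_lt (hgt i)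
  have hqn : ∀ i, Fintype.card F < n i := fun i => (le_max_right _ _).trans_lt (hgt i)
  have hodd : ∀ i, Odd (n i) := fun i => (hprime i).odd_of_ne_two (by have := hqn i; omega)
  have hne : ∀ i, NeZero (n i) := fun i => ⟨(hprime i).ne_zero⟩
  have hnF : ∀ i, (n i : F) ≠ 0 := fun i h => by
    rw [CharP.cast_eq_zero_iff F 2] at h
    exact (Nat.not_even_iff_odd.2 (hodd i)) (even_iff_two_dvd.2 h)
  have hn : Filter.Tendsto n Filter.atTop Filter.atTop :=
    Filter.tendsto_atTop_mono (fun i => (hi i).le) Filter.tendsto_id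
  -- The order `s` satisfies `s³ ≥ n i > i`.
  have hs : Filter.Tendsto (fun i => orderOf (Fintype.card F : ZMod (n i))) Filter.atTop Filter.atTop := by
    refine Filter.tendsto_atTop.2 fun b => ?_
    filter_upwards [Filter.eventually_ge_atTop (b ^ 3)] with i hb
    by_contra hlt
    have h1 := Nat.pow_le_pow_left (not_le.1 hlt).le 3
    have h2 := hi i
    have h3 := hord i
    omega
  have hchoice : ∀ i, ∀ ε ∈ DihedralCode.blockIds F (n i),
      Nonempty (DihedralCode.BlockChoice F (n i) ε) := fun i ε hε =>
    DihedralCode.nonempty_blockChoice (hnF i) (hodd i) ε hε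
  have hlim : ∀ B : ∀ i, ∀ ε : DihedralCode.blockIds F (n i),
      DihedralCode.BlockChoice F (n i) (ε : DihedralCode.FG F (n i)),
      Filter.Tendsto (fun i => DihedralCode.probGT (B i) δ) Filter.atTop (nhds 1) := fun B =>
    tendsto_of_tendsto_of_tendsto_of_le_of_le (DihedralCode.tendsto_probGT_bound hq hh1 hs)
      tendsto_const_nhds
      (fun i => DihedralCode.le_probGT (hprime i) (hnF i) (B i) hδ0 hδ1 hh0 hh1 rfl (hord i))
      (fun i => DihedralCode.probGT_le_one (B i) δ)
  have hgroup : ∀ B : ∀ i, ∀ ε : DihedralCode.blockIds F (n i),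
      DihedralCode.BlockChoice F (n i) (ε : DihedralCode.FG F (n i)),
      ∀ i, ∀ α ∈ DihedralCode.Kstar (B i), ∀ β ∈ DihedralCode.Kstar (B i),
          DihedralCode.IsGroupCode (DihedralCode.randomCode (B i) α β) ∧
          DihedralCode.IsSelfDual (DihedralCode.randomCode (B i) α β) := fun B i α hα β hβ =>
    ⟨DihedralCode.isGroupCode_randomCode (hnF i) hα hβ,
      DihedralCode.isSelfDual_randomCode (hnF i) hα hβ⟩
  refine ⟨?_, n, fun i => ⟨(hprime i).one_lt, hodd i, ?_⟩, hn, hchoice, fun B => ⟨hgroup B, hlim B⟩⟩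
  · let B : ∀ i, ∀ ε : DihedralCode.blockIds F (n i),
      DihedralCode.BlockChoice F (n i) (ε : DihedralCode.FG F (n i)) := fun i ε =>
        (hchoice i ε ε.2).some
    -- From some index on the probability is positive, so a good pair exists; part (a) uses the
    -- sequence shifted by `N`.
    obtain ⟨N, hN⟩ := Filter.eventually_atTop.1 ((hlim B).eventually (lt_mem_nhds zero_lt_one))
    have hex : ∀ i, ∃ C : Ideal (MonoidAlgebra F (DihedralGroup (n (i + N)))),
        DihedralCode.IsSelfDual (C : Set (MonoidAlgebra F (DihedralGroup (n (i + N))))) ∧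
        δ < DihedralCode.relMinDist (C : Set (MonoidAlgebra F (DihedralGroup (n (i + N))))) := by
      intro i
      have hpos := hN (i + N) (Nat.le_add_left _ _)
      have hnonempty : {p ∈ DihedralCode.Kstar (B (i + N)) ×ˢ DihedralCode.Kstar (B (i + N)) |
          δ < DihedralCode.relMinDist (DihedralCode.randomCode (B (i + N)) p.1 p.2)}.Nonempty := by
        by_contra hemp
        rw [Set.not_nonempty_iff_eq_empty] at hemp
        rw [DihedralCode.probGT, hemp] at hpos
        simp at hpos
      obtain ⟨p, ⟨hα, hβ⟩, hd⟩ := hnonempty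
      obtain ⟨⟨C, hC⟩, hsd⟩ := hgroup B (i + N) p.1 hα p.2 hβ
      exact ⟨C, by rw [hC]; exact hsd, by rw [hC]; exact hd⟩
    choose C hC using hex
    refine ⟨fun i => n (i + N), C, fun i => (hprime _).one_lt, ?_, hC⟩
    simp only [DihedralGroup.nat_card]
    refine Filter.tendsto_atTop_mono (fun i => ?_) Filter.tendsto_id
    have := hi (i + N)
    simp only [id]
    omega
  · exact ((hprime i).coprime_iff_not_dvd).2 fun h =>
      absurd (Nat.le_of_dvd Fintype.card_pos h) (not_le.2 (hqn i))
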